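/- A Jacobi diagram with free legs $\Sigma$ ($\Sigma$ a finite set) is an isomorphism class of finite graphs $D$ whose vertices are univalent or trivalent, with a cyclic order of the half-edges at each trivalent vertex, a bijection between the set of univalent vertices and $\Sigma$, and possibly closed edges without vertices; a diagram is closed if $\Sigma=\emptyset$. Its degree is half its number of vertices. Let $\mathring{\mathcal A}(\Sigma)$ be the graded $\mathbb C$-vector space generated by these diagrams modulo the AS and IHX relations, and $\mathring{\mathcal A}^\wedge(\Sigma)=\prod_{d\ge 0}\mathring{\mathcal A}(\Sigma)[d]$ its degree completion. Then $\mathring{\mathcal A}^\wedge_0:=\mathring{\mathcal A}^\wedge(\emptyset)$ is a commutative algebra with product induced by disjoint union. Gluing the legs with equal labels induces a continuous bilinear pairing $\langle\cdot,\cdot\rangle:\mathring{\mathcal A}^\wedge(\Sigma)\times\mathring{\mathcal A}^\wedge(\Sigma)\to\mathring{\mathcal A}^\wedge_0$. For $k\ge 1$ let $\varsigma_k\in\mathring{\mathcal A}^\wedge(\{1,\dots,2k\})$ be the sum, over all fixed-point free involutions $\tau$ of $\{1,\dots,2k\}$, of the disjoint unions of $k$ segments joining $s$ to $\tau(s)$,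 and let $$P^{k}_0=\{\langle x,\varsigma_k\rangle : x\in\mathring{\mathcal A}^\wedge(\{1,\dots,2k\})\},$$ which is an ideal of $\mathring{\mathcal A}^\wedge_0$. Let $X\in\mathring{\mathcal A}^\wedge_0$ be the class of the closed edge without vertices, $O^n$ the closed ideal generated by $X+2n$ (closed for the degree topology), and $\mathring{\mathcal A}^\wedge_0[>n]$ the ideal of the elements whose components of degree $\le n$ vanish. For $n\ge 1$ put $$\mathfrak c(n)=\mathring{\mathcal A}^\wedge_0/(P^{n+1}_0+O^n),\qquad \mathfrak d(n)=\mathring{\mathcal A}^\wedge_0/(P^{n+1}_0+O^n+\mathring{\mathcal A}^\wedge_0[>n]),$$ and let $\mathrm{pr}_n:\mathfrak c(n)\to\mathfrak d(n)$ be the canonical projection. Proposition. For every $m\ge 2$ the degree $m$ part of $\mathring{\mathcal A}^\wedge_0/P^2_0$ is zero. The map $\mathrm{pr}_1:\mathfrak c(1)\to\mathfrak d(1)$ is an isomorphism of $\mathbb C$-algebras, and $\mathfrak c(1)=\mathfrak d(1)$, that is, $P^2_0+O^1=P^2_0+O^1+\mathring{\mathcal A}^\wedge_0[>1]$. -/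

import Mathlib

namespace Jacobi

/-! ### First return maps of permutations -/

theorem exists_return {α : Type} [Finite α] (ρ : Equiv.Perm α) (p : α → Prop) (x : Subtype p) :
    ∃ k : ℕ, p ((ρ ^ (k + 1)) x) := by
  refine ⟨orderOf ρ - 1, ?_⟩
  rw [Nat.sub_add_cancel (orderOf_pos ρ), pow_orderOf_eq_one]
  exact x.2

open Classical in
/-- The first point of the orbit `ρ x, ρ² x, …` that satisfies `p`. -/
noncomputable def firstReturn {α : Type} [Finite α] (ρ : Equiv.Perm α) (p : α → Prop)
    (x : Subtype p) : Subtype p :=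
  ⟨(ρ ^ (Nat.find (exists_return ρ p x) + 1)) x, Nat.find_spec (exists_return ρ p x)⟩

theorem firstReturn_spec {α : Type} [Finite α] (ρ : Equiv.Perm α) (p : α → Prop)
    (x : Subtype p) :
    ∃ k : ℕ, (ρ ^ (k + 1)) x = (firstReturn ρ p x : α) ∧ ∀ j < k, ¬ p ((ρ ^ (j + 1)) x) := by
  classical
  exact ⟨Nat.find (exists_return ρ p x), rfl, fun j hj => Nat.find_min _ hj⟩

theorem firstReturn_eq {α : Type} [Finite α] {ρ : Equiv.Perm α} {p : α → Prop}
    {x y : Subtype p} (k : ℕ) (h : (ρ ^ (k + 1)) x = (y : α))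
    (hmin : ∀ j < k, ¬ p ((ρ ^ (j + 1)) x)) : firstReturn ρ p x = y := by
  classical
  have hk : Nat.find (exists_return ρ p x) = k := by
    rw [Nat.find_eq_iff]
    exact ⟨by rw [h]; exact y.2, hmin⟩
  apply Subtype.ext
  simp only [firstReturn]
  rw [hk, h]

/-- First return maps are compatible with maps intertwining the permutations. -/
theorem firstReturn_map {α β : Type} [Finite α] [Finite β] {ρ : Equiv.Perm α}
    {ρ' : Equiv.Perm β} {p : α → Prop} {q : β → Prop} (e : α → β)
    (he : ∀ a, e (ρ a) = ρ' (e a)) (hp : ∀ a, q (e a) ↔ p a) (x : Subtype p) :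
    firstReturn ρ' q ⟨e x, (hp x).2 x.2⟩ =
      ⟨e (firstReturn ρ p x), (hp _).2 (firstReturn ρ p x).2⟩ := by
  have hpow : ∀ (k : ℕ) (a : α), e ((ρ ^ k) a) = (ρ' ^ k) (e a) := by
    intro k
    induction k with
    | zero => intro a; rfl
    | succ k ih => intro a; rw [pow_succ, pow_succ, Equiv.Perm.mul_apply, ih, he]; rfl
  obtain ⟨k, hk, hmin⟩ := firstReturn_spec ρ p x
  refine firstReturn_eq k ?_ ?_
  · rw [← hpow, hk]
  · intro j hj hq
    rw [← hpow, hp] at hq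
    exact hmin j hj hq

section Involutions

variable {α : Type} {f g : Equiv.Perm α}

theorem conj_pow (hf : ∀ a, f (f a) = a) (hg : ∀ a, g (g a) = a) (k : ℕ) (a : α) :
    ((f * g) ^ k) (g (((f * g) ^ k) a)) = g a := by
  induction k generalizing a with
  | zero => rfl
  | succ k ih =>
    have h1 : ∀ y, (f * g) (g ((f * g) y)) = g y := by
      intro y
      simp [Equiv.Perm.mul_apply, hf, hg]
    have h2 : ((f * g) ^ (k + 1)) a = (f * g) (((f * g) ^ k) a) := by
      rw [pow_succ', Equiv.Perm.mul_apply]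
    rw [h2, pow_succ, Equiv.Perm.mul_apply, h1, ih]

variable [Finite α] {p : α → Prop}

theorem firstReturn_invol (hf : ∀ a, f (f a) = a) (hg : ∀ a, g (g a) = a)
    (hgp : ∀ a, p a → g a = a) (x : Subtype p) :
    firstReturn (f * g) p (firstReturn (f * g) p x) = x := by
  have hgp' : ∀ a, p (g a) → p a := by
    intro a ha
    have := hgp _ ha
    rw [hg] at this
    rwa [← this] at ha
  obtain ⟨k, hk, hmin⟩ := firstReturn_spec (f * g) p x
  set y := firstReturn (f * g) p x with hy
  have key : ∀ j ≤ k + 1, ((f * g) ^ j) y = g (((f * g) ^ (k + 1 - j)) x) := by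
    intro j hj
    have h1 := conj_pow hf hg j (((f * g) ^ (k + 1 - j)) (x : α))
    rw [← Equiv.Perm.mul_apply (((f * g) ^ j)) (((f * g) ^ (k + 1 - j))), ← pow_add,
      Nat.add_sub_cancel' hj, hk, hgp _ y.2] at h1
    exact h1
  refine firstReturn_eq k ?_ ?_
  · rw [key _ le_rfl, Nat.sub_self]
    exact hgp _ x.2
  · intro j hj h
    rw [key _ (by omega)] at h
    refine hmin (k - j - 1) (by omega) ?_
    have e : k - j - 1 + 1 = k + 1 - (j + 1) := by omega
    rw [e]
    exact hgp' _ h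

theorem firstReturn_ne (hf : ∀ a, f (f a) = a) (hf' : ∀ a, f a ≠ a) (hg : ∀ a, g (g a) = a)
    (hgp : ∀ a, p a → g a = a) (hgn : ∀ a, ¬ p a → g a ≠ a) (x : Subtype p) :
    firstReturn (f * g) p x ≠ x := by
  intro hx
  obtain ⟨k, hk, hmin⟩ := firstReturn_spec (f * g) p x
  rw [hx] at hk
  have key : ∀ j ≤ k + 1, ((f * g) ^ j) (x : α) = g (((f * g) ^ (k + 1 - j)) x) := by
    intro j hj
    have h1 := conj_pow hf hg j (((f * g) ^ (k + 1 - j)) (x : α))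
    rw [← Equiv.Perm.mul_apply (((f * g) ^ j)) (((f * g) ^ (k + 1 - j))), ← pow_add,
      Nat.add_sub_cancel' hj, hk, hgp _ x.2] at h1
    exact h1
  rcases Nat.even_or_odd' (k + 1) with ⟨i, hi | hi⟩
  · have h := key i (by omega)
    have e : k + 1 - i = i := by omega
    rw [e] at h
    have h3 := hmin (i - 1) (by omega)
    have e2 : i - 1 + 1 = i := by omega
    rw [e2] at h3
    exact hgn _ h3 h.symm
  · have h := key (i + 1) (by omega)
    have e : k + 1 - (i + 1) = i := by omega
    rw [e, pow_succ', Equiv.Perm.mul_apply, Equiv.Perm.mul_apply] at h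
    exact hf' _ h

end Involutions

/-! ### Jacobi diagrams -/

/-- A vertex-oriented unitrivalent graph whose univalent vertices are labelled bijectively by `L`
(a Jacobi diagram with free legs `L`), given by its finite set of half-edges: the cycles of `next`
are the vertices with the cyclic order of their half-edges (a fixed point is a univalent vertex,
a 3-cycle is a trivalent vertex), the orbits of the fixed-point free involution `flip` are the
edges, and `loops` is the number of closed edges without vertices. -/
structure Diagram (L : Type) : Type 1 where
  HalfEdge : Type
  finite : Finite HalfEdge
  next : Equiv.Perm HalfEdge
  next_next_next : ∀ h, next (next (next h)) = h
  flip : Equiv.Perm HalfEdge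
  flip_flip : ∀ h, flip (flip h) = h
  flip_ne : ∀ h, flip h ≠ h
  leg : L → HalfEdge
  leg_injective : Function.Injective leg
  next_eq_iff : ∀ h, next h = h ↔ ∃ s, leg s = h
  loops : ℕ

attribute [instance] Diagram.finite

namespace Diagram

variable {L L' : Type}

/-- An isomorphism of graphs with all structures. -/
def Iso (D D' : Diagram L) : Prop :=
  ∃ e : D.HalfEdge ≃ D'.HalfEdge, (∀ h, e (D.next h) = D'.next (e h)) ∧
    (∀ h, e (D.flip h) = D'.flip (e h)) ∧ (∀ s, e (D.leg s) = D'.leg s) ∧ D.loops = D'.loops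

theorem Iso.refl (D : Diagram L) : Iso D D :=
  ⟨Equiv.refl _, fun _ => rfl, fun _ => rfl, fun _ => rfl, rfl⟩

theorem Iso.symm {D D' : Diagram L} : Iso D D' → Iso D' D := by
  rintro ⟨e, h1, h2, h3, h4⟩
  refine ⟨e.symm, fun h => ?_, fun h => ?_, fun s => ?_, h4.symm⟩
  · rw [Equiv.symm_apply_eq, h1]; simp
  · rw [Equiv.symm_apply_eq, h2]; simp
  · rw [Equiv.symm_apply_eq, h3]

theorem Iso.trans {D D' D'' : Diagram L} : Iso D D' → Iso D' D'' → Iso D D'' := by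
  rintro ⟨e, h1, h2, h3, h4⟩ ⟨e', h1', h2', h3', h4'⟩
  exact ⟨e.trans e', fun h => by simp [h1, h1'], fun h => by simp [h2, h2'],
    fun s => by simp [h3, h3'], h4.trans h4'⟩

instance setoid (L : Type) : Setoid (Diagram L) where
  r := Iso
  iseqv := ⟨Iso.refl, Iso.symm, Iso.trans⟩

/-- The number of trivalent vertices: each of them consists of three half-edges. -/
noncomputable def numTrivalent (D : Diagram L) : ℕ := Nat.card {h // D.next h ≠ h} / 3

/-- Half the number of vertices. -/
noncomputable def degree (D : Diagram L) : ℕ := (D.numTrivalent + Nat.card L) / 2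

/-- The graph obtained by keeping the vertices and regluing the edges: the half-edge slot `h` takes
over the edge end that was at `π h`. -/
def reattach (D : Diagram L) (π : Equiv.Perm D.HalfEdge) : Diagram L where
  HalfEdge := D.HalfEdge
  finite := D.finite
  next := D.next
  next_next_next := D.next_next_next
  flip := π⁻¹ * D.flip * π
  flip_flip h := by simp [D.flip_flip]
  flip_ne h := by
    intro hh
    rw [Equiv.Perm.mul_apply, Equiv.Perm.mul_apply, Equiv.Perm.inv_eq_iff_eq] at hh
    exact D.flip_ne _ hh
  leg := D.leg
  leg_injective := D.leg_injective
  next_eq_iff := D.next_eq_iff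
  loops := D.loops

open Classical in
/-- The exchange of the two half-edges which follow `h` at the vertex of `h`. -/
noncomputable def asPerm (D : Diagram L) (h : D.HalfEdge) : Equiv.Perm D.HalfEdge :=
  Equiv.swap (D.next h) (D.next (D.next h))

open Classical in
/-- If the edge of `h` joins two vertices with cyclically ordered half-edges `(h, a, b)` and
`(flip h, c, d)`, this is the cyclic permutation `a ↦ b ↦ c ↦ a`. -/
noncomputable def ihxPerm (D : Diagram L) (h : D.HalfEdge) : Equiv.Perm D.HalfEdge :=
  Equiv.swap (D.next h) (D.next (D.next h)) *
    Equiv.swap (D.next (D.next h)) (D.next (D.flip h))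

/-- The edge of `h` joins two distinct trivalent vertices. -/
def IsInnerEdge (D : Diagram L) (h : D.HalfEdge) : Prop :=
  D.next h ≠ h ∧ D.next (D.flip h) ≠ D.flip h ∧ D.flip h ≠ D.next h ∧
    D.flip h ≠ D.next (D.next h)

/-- The disjoint union. -/
def sqcup (D : Diagram L) (D' : Diagram L') : Diagram (L ⊕ L') where
  HalfEdge := D.HalfEdge ⊕ D'.HalfEdge
  finite := inferInstance
  next := Equiv.Perm.sumCongr D.next D'.next
  next_next_next := by rintro (h | h) <;> simp [next_next_next]
  flip := Equiv.Perm.sumCongr D.flip D'.flip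
  flip_flip := by rintro (h | h) <;> simp [flip_flip]
  flip_ne := by rintro (h | h) <;> simp [flip_ne]
  leg := Sum.map D.leg D'.leg
  leg_injective := D.leg_injective.sumMap D'.leg_injective
  next_eq_iff := by rintro (h | h) <;> simp [next_eq_iff]
  loops := D.loops + D'.loops

/-- Renaming of the legs. -/
def relabel (e : L ≃ L') (D : Diagram L) : Diagram L' where
  HalfEdge := D.HalfEdge
  finite := D.finite
  next := D.next
  next_next_next := D.next_next_next
  flip := D.flip
  flip_flip := D.flip_flip
  flip_ne := D.flip_ne
  leg := D.leg ∘ e.symm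
  leg_injective := D.leg_injective.comp e.symm.injective
  next_eq_iff h := by
    rw [D.next_eq_iff]
    exact ⟨fun ⟨s, hs⟩ => ⟨e s, by simpa using hs⟩, fun ⟨s, hs⟩ => ⟨e.symm s, hs⟩⟩
  loops := D.loops

end Diagram

/-- Fixed-point free involutions. -/
def FPFI (L : Type) : Type := {τ : Equiv.Perm L // ∀ s, τ (τ s) = s ∧ τ s ≠ s}

noncomputable instance FPFI.fintype (L : Type) [Finite L] : Fintype (FPFI L) :=
  have : Finite (FPFI L) := Subtype.finite
  Fintype.ofFinite _

/-- The exchange of the two copies of `L`. -/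
def FPFI.exchange (L : Type) : FPFI (L ⊕ L) :=
  ⟨Equiv.sumComm L L, by rintro (s | s) <;> simp⟩

namespace Diagram

variable {L L' : Type}

/-- The empty diagram. -/
def empty : Diagram Empty where
  HalfEdge := Empty
  finite := inferInstance
  next := 1
  next_next_next h := h.elim
  flip := 1
  flip_flip h := h.elim
  flip_ne h := h.elim
  leg := id
  leg_injective := fun a => a.elim
  next_eq_iff h := h.elim
  loops := 0

/-- The dashed loop: the connected closed diagram without vertices. -/
def loop : Diagram Empty := { empty with loops := 1 }

/-- The disjoint union of segments with endpoints `s` and `τ s`. -/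
def strut [Finite L] (τ : FPFI L) : Diagram L where
  HalfEdge := L
  finite := inferInstance
  next := 1
  next_next_next _ := rfl
  flip := τ.1
  flip_flip s := (τ.2 s).1
  flip_ne s := (τ.2 s).2
  leg := id
  leg_injective := fun _ _ h => h
  next_eq_iff h := by simp
  loops := 0

/-! #### Gluing of legs -/

open Classical in
/-- The involution of the half-edges which sends the leg `s` to the leg `τ s` and fixes the
half-edges at trivalent vertices. -/
noncomputable def legInv (D : Diagram L) (τ : FPFI L) : Equiv.Perm D.HalfEdge :=
  τ.1.extendDomain (Equiv.ofInjective D.leg D.leg_injective)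

theorem legInv_leg (D : Diagram L) (τ : FPFI L) (s : L) :
    D.legInv τ (D.leg s) = D.leg (τ.1 s) := by
  classical
  exact Equiv.Perm.extendDomain_apply_image τ.1 (Equiv.ofInjective D.leg D.leg_injective) s

theorem legInv_of_next_ne (D : Diagram L) (τ : FPFI L) (h : D.HalfEdge) (hh : D.next h ≠ h) :
    D.legInv τ h = h := by
  classical
  refine Equiv.Perm.extendDomain_apply_not_subtype _ _ ?_
  intro hs
  exact hh ((D.next_eq_iff h).2 hs)

theorem legInv_legInv (D : Diagram L) (τ : FPFI L) (h : D.HalfEdge) :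
    D.legInv τ (D.legInv τ h) = h := by
  by_cases hh : D.next h = h
  · obtain ⟨s, rfl⟩ := (D.next_eq_iff h).1 hh
    rw [legInv_leg, legInv_leg, (τ.2 s).1]
  · rw [legInv_of_next_ne _ _ _ hh, legInv_of_next_ne _ _ _ hh]

theorem legInv_ne (D : Diagram L) (τ : FPFI L) (h : D.HalfEdge) (hh : D.next h = h) :
    D.legInv τ h ≠ h := by
  obtain ⟨s, rfl⟩ := (D.next_eq_iff h).1 hh
  rw [legInv_leg]
  exact fun e => (τ.2 s).2 (D.leg_injective e)

/-- The closed graph obtained by gluing the leg `s` to the leg `τ s` for all `s`.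
Its half-edges are the half-edges `h` of `D` at trivalent vertices. The other end of the edge
starting at `h` is found by moving to `flip h`, which either is at a trivalent vertex or is a leg;
in the latter case one jumps to the leg glued to it, moves on by `flip`, and so on.
The paths consisting only of legs close up to new loops without vertices. -/
noncomputable def glue (D : Diagram L) (τ : FPFI L) : Diagram Empty where
  HalfEdge := {h // D.next h ≠ h}
  finite := inferInstance
  next := D.next.subtypePerm (by simp)
  next_next_next h := Subtype.ext (by simp [D.next_next_next])
  flip := Function.Involutive.toPerm
    (firstReturn (D.flip * D.legInv τ) (fun h => D.next h ≠ h))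
    (firstReturn_invol D.flip_flip (D.legInv_legInv τ) (D.legInv_of_next_ne τ))
  flip_flip := firstReturn_invol D.flip_flip (D.legInv_legInv τ) (D.legInv_of_next_ne τ)
  flip_ne := firstReturn_ne D.flip_flip D.flip_ne (D.legInv_legInv τ) (D.legInv_of_next_ne τ)
    (fun h hh => D.legInv_ne τ h (not_not.1 hh))
  leg := Empty.elim
  leg_injective := fun a => a.elim
  next_eq_iff := by
    rintro ⟨h, hh⟩
    simpa [Subtype.ext_iff] using hh
  loops := D.loops + Nat.card
    {c : Quot (fun x y : D.HalfEdge => y = D.flip x ∨ y = D.legInv τ x) //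
      ∀ h, Quot.mk _ h = c → D.next h = h}

end Diagram

/-! ### Compatibility of the operations with isomorphisms and local modifications -/

namespace Diagram

variable {L L' L'' : Type}

theorem Iso.of_eq {D D' : Diagram L} (h : D = D') : Iso D D' := h ▸ Iso.refl D

theorem next_next_ne {D : Diagram L} {h : D.HalfEdge} (hh : D.next h ≠ h) :
    D.next (D.next h) ≠ D.next h := fun e => hh (D.next.injective e)

/-- A construction with diagrams that respects isomorphisms and turns a modification as in the
AS and IHX relations into a modification of the same kind. -/
structure IsLocal (F : Diagram L → Diagram L') : Prop where
  iso : ∀ D D', Iso D D' → Iso (F D) (F D')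
  as : ∀ (D : Diagram L) (h : D.HalfEdge), D.next h ≠ h →
    ∃ h' : (F D).HalfEdge, (F D).next h' ≠ h' ∧
      Iso (F (D.reattach (D.asPerm h))) ((F D).reattach ((F D).asPerm h'))
  ihx : ∀ (D : Diagram L) (h : D.HalfEdge), D.IsInnerEdge h →
    ∃ h' : (F D).HalfEdge, (F D).IsInnerEdge h' ∧
      Iso (F (D.reattach (D.ihxPerm h))) ((F D).reattach ((F D).ihxPerm h')) ∧
      Iso (F (D.reattach (D.ihxPerm h)⁻¹)) ((F D).reattach ((F D).ihxPerm h')⁻¹)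

theorem isLocal_relabel (e : L ≃ L') : IsLocal (relabel e) where
  iso := by
    rintro D D' ⟨f, h1, h2, h3, h4⟩
    exact ⟨f, h1, h2, fun s => h3 _, h4⟩
  as D h hh := ⟨h, hh, Iso.refl _⟩
  ihx D h hh := ⟨h, hh, Iso.refl _, Iso.refl _⟩

open Classical in
theorem map_swap {α β : Type} (i : α → β) (hi : Function.Injective i) (a b x : α) :
    Equiv.swap (i a) (i b) (i x) = i (Equiv.swap a b x) :=
  hi.swap_apply a b x

open Classical in
theorem map_swap_swap {α β : Type} (i : α → β) (hi : Function.Injective i) (a b c d x : α) :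
    (Equiv.swap (i a) (i b) * Equiv.swap (i c) (i d)) (i x) =
      i ((Equiv.swap a b * Equiv.swap c d) x) := by
  rw [Equiv.Perm.mul_apply, Equiv.Perm.mul_apply, map_swap i hi, map_swap i hi]

open Classical in
theorem swap_swap_of_ne {α : Type} {a b c d x : α} (ha : x ≠ a) (hb : x ≠ b) (hc : x ≠ c)
    (hd : x ≠ d) : (Equiv.swap a b * Equiv.swap c d) x = x := by
  rw [Equiv.Perm.mul_apply, Equiv.swap_apply_of_ne_of_ne hc hd,
    Equiv.swap_apply_of_ne_of_ne ha hb]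

theorem sqcup_iso {D₁ D₂ : Diagram L} {E₁ E₂ : Diagram L'} (h : Iso D₁ D₂) (k : Iso E₁ E₂) :
    Iso (D₁.sqcup E₁) (D₂.sqcup E₂) := by
  obtain ⟨f, h1, h2, h3, h4⟩ := h
  obtain ⟨g, k1, k2, k3, k4⟩ := k
  refine ⟨Equiv.sumCongr f g, ?_, ?_, ?_, congrArg₂ (· + ·) h4 k4⟩
  · rintro (x | x)
    · exact congrArg Sum.inl (h1 x)
    · exact congrArg Sum.inr (k1 x)
  · rintro (x | x)
    · exact congrArg Sum.inl (h2 x)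
    · exact congrArg Sum.inr (k2 x)
  · rintro (x | x)
    · exact congrArg Sum.inl (h3 x)
    · exact congrArg Sum.inr (k3 x)

theorem inv_map {α β : Type} {π : Equiv.Perm α} {π' : Equiv.Perm β} {i : α → β}
    (h : ∀ x, π' (i x) = i (π x)) (x : α) : π'⁻¹ (i x) = i (π⁻¹ x) := by
  rw [Equiv.Perm.inv_eq_iff_eq, h]
  simp

theorem sqcup_reattach_left (D : Diagram L) (E : Diagram L') (π : Equiv.Perm D.HalfEdge)
    (π' : Equiv.Perm (D.sqcup E).HalfEdge) (hl : ∀ x, π' (Sum.inl x) = Sum.inl (π x))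
    (hr : ∀ x, π' (Sum.inr x) = Sum.inr x) :
    Iso ((D.reattach π).sqcup E) ((D.sqcup E).reattach π') := by
  refine ⟨Equiv.refl _, fun _ => rfl, ?_, fun _ => rfl, rfl⟩
  rintro (x | x)
  · change Sum.inl (π⁻¹ (D.flip (π x))) = π'⁻¹ ((D.sqcup E).flip (π' (Sum.inl x)))
    exact ((congrArg (fun y => π'⁻¹ ((D.sqcup E).flip y)) (hl x)).trans
      (inv_map hl (D.flip (π x)))).symm
  · change Sum.inr (E.flip x) = π'⁻¹ ((D.sqcup E).flip (π' (Sum.inr x)))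
    rw [hr]
    exact (inv_map (π := 1) hr _).symm

theorem sqcup_reattach_right (D : Diagram L) (E : Diagram L') (π : Equiv.Perm E.HalfEdge)
    (π' : Equiv.Perm (D.sqcup E).HalfEdge) (hl : ∀ x, π' (Sum.inl x) = Sum.inl x)
    (hr : ∀ x, π' (Sum.inr x) = Sum.inr (π x)) :
    Iso (D.sqcup (E.reattach π)) ((D.sqcup E).reattach π') := by
  refine ⟨Equiv.refl _, fun _ => rfl, ?_, fun _ => rfl, rfl⟩
  rintro (x | x)
  · change Sum.inl (D.flip x) = π'⁻¹ ((D.sqcup E).flip (π' (Sum.inl x)))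
    rw [hl]
    exact (inv_map (π := 1) hl _).symm
  · change Sum.inr (π⁻¹ (E.flip (π x))) = π'⁻¹ ((D.sqcup E).flip (π' (Sum.inr x)))
    exact ((congrArg (fun y => π'⁻¹ ((D.sqcup E).flip y)) (hr x)).trans
      (inv_map hr (E.flip (π x)))).symm

theorem isLocal_sqcup_left (E : Diagram L') : IsLocal (fun D : Diagram L => D.sqcup E) where
  iso D D' h := sqcup_iso h (Iso.refl E)
  as D h hh := by
    classical
    refine ⟨Sum.inl h, fun e => hh (Sum.inl_injective e), sqcup_reattach_left _ _ _ _ ?_ ?_⟩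
    · exact fun x => map_swap Sum.inl Sum.inl_injective _ _ _
    · exact fun x => Equiv.swap_apply_of_ne_of_ne Sum.inr_ne_inl Sum.inr_ne_inl
  ihx D h hh := by
    classical
    have hl : ∀ x, (D.sqcup E).ihxPerm (Sum.inl h) (Sum.inl x) = Sum.inl (D.ihxPerm h x) := by
      exact fun x => map_swap_swap Sum.inl Sum.inl_injective _ _ _ _ _
    have hr : ∀ x, (D.sqcup E).ihxPerm (Sum.inl h) (Sum.inr x) = Sum.inr x := by
      exact fun x => swap_swap_of_ne Sum.inr_ne_inl Sum.inr_ne_inl Sum.inr_ne_inl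
        Sum.inr_ne_inl
    obtain ⟨h1, h2, h3, h4⟩ := hh
    exact ⟨Sum.inl h, ⟨fun e => h1 (Sum.inl_injective e), fun e => h2 (Sum.inl_injective e),
      fun e => h3 (Sum.inl_injective e), fun e => h4 (Sum.inl_injective e)⟩,
      sqcup_reattach_left _ _ _ _ hl hr,
      sqcup_reattach_left _ _ _ _ (inv_map hl) (inv_map (π := 1) hr)⟩

theorem isLocal_sqcup_right (D : Diagram L) : IsLocal (fun E : Diagram L' => D.sqcup E) where
  iso E E' h := sqcup_iso (Iso.refl D) h
  as E h hh := by
    classical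
    refine ⟨Sum.inr h, fun e => hh (Sum.inr_injective e), sqcup_reattach_right _ _ _ _ ?_ ?_⟩
    · exact fun x => Equiv.swap_apply_of_ne_of_ne Sum.inl_ne_inr Sum.inl_ne_inr
    · exact fun x => map_swap Sum.inr Sum.inr_injective _ _ _
  ihx E h hh := by
    classical
    have hr : ∀ x, (D.sqcup E).ihxPerm (Sum.inr h) (Sum.inr x) = Sum.inr (E.ihxPerm h x) := by
      exact fun x => map_swap_swap Sum.inr Sum.inr_injective _ _ _ _ _
    have hl : ∀ x, (D.sqcup E).ihxPerm (Sum.inr h) (Sum.inl x) = Sum.inl x := by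
      exact fun x => swap_swap_of_ne Sum.inl_ne_inr Sum.inl_ne_inr Sum.inl_ne_inr
        Sum.inl_ne_inr
    obtain ⟨h1, h2, h3, h4⟩ := hh
    exact ⟨Sum.inr h, ⟨fun e => h1 (Sum.inr_injective e), fun e => h2 (Sum.inr_injective e),
      fun e => h3 (Sum.inr_injective e), fun e => h4 (Sum.inr_injective e)⟩,
      sqcup_reattach_right _ _ _ _ hl hr,
      sqcup_reattach_right _ _ _ _ (inv_map (π := 1) hl) (inv_map hr)⟩

theorem map_legInv {D D' : Diagram L} (τ : FPFI L) (e : D.HalfEdge ≃ D'.HalfEdge)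
    (hn : ∀ h, e (D.next h) = D'.next (e h)) (hl : ∀ s, e (D.leg s) = D'.leg s) (h : D.HalfEdge) :
    e (D.legInv τ h) = D'.legInv τ (e h) := by
  by_cases hh : D.next h = h
  · obtain ⟨s, rfl⟩ := (D.next_eq_iff h).1 hh
    rw [legInv_leg, hl, hl, legInv_leg]
  · rw [legInv_of_next_ne _ _ _ hh, legInv_of_next_ne]
    rw [← hn]
    exact fun h' => hh (e.injective h')

/-- The number of circles created by a gluing only depends on the involutions up to conjugation. -/
theorem card_circles_congr {α β : Type} (e : α ≃ β) {f g n : α → α} {f' g' n' : β → β}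
    (hf : ∀ x, e (f x) = f' (e x)) (hg : ∀ x, e (g x) = g' (e x))
    (hn : ∀ x, n' (e x) = e x ↔ n x = x) :
    Nat.card {c : Quot (fun x y : α => y = f x ∨ y = g x) // ∀ h, Quot.mk _ h = c → n h = h} =
    Nat.card {c : Quot (fun x y : β => y = f' x ∨ y = g' x) //
      ∀ h, Quot.mk _ h = c → n' h = h} := by
  have hr : ∀ x y : α, (y = f x ∨ y = g x) ↔ (e y = f' (e x) ∨ e y = g' (e x)) := by
    intro x y
    rw [← hf, ← hg, e.apply_eq_iff_eq, e.apply_eq_iff_eq]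
  let E : Quot (fun x y : α => y = f x ∨ y = g x) ≃ Quot (fun x y : β => y = f' x ∨ y = g' x) :=
    Quot.congr e hr
  refine Nat.card_congr (Equiv.subtypeEquiv E ?_)
  intro c
  constructor
  · intro h b hb
    obtain ⟨a, rfl⟩ := e.surjective b
    refine (hn a).2 (h a ?_)
    apply E.injective
    exact hb
  · intro h a ha
    refine (hn a).1 (h (e a) ?_)
    rw [← ha]
    rfl

theorem glue_iso (τ : FPFI L) {D D' : Diagram L} (h : Iso D D') : Iso (D.glue τ) (D'.glue τ) := by
  obtain ⟨e, h1, h2, h3, h4⟩ := h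
  have hg := map_legInv τ e h1 h3
  have hp : ∀ a, D'.next (e a) ≠ e a ↔ D.next a ≠ a := fun a => by
    rw [← h1, Ne, e.apply_eq_iff_eq]
  refine ⟨Equiv.subtypeEquiv e fun a => (hp a).symm, ?_, ?_, fun s => s.elim, ?_⟩
  · rintro ⟨x, hx⟩
    exact Subtype.ext (h1 x)
  · intro x
    exact (firstReturn_map (ρ := D.flip * D.legInv τ) (ρ' := D'.flip * D'.legInv τ)
      (p := fun h => D.next h ≠ h) (q := fun h => D'.next h ≠ h) e
      (fun a => by simp [Equiv.Perm.mul_apply, h2, hg]) hp x).symm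
  · simp only [glue, h4]
    congr 1
    exact card_circles_congr e h2 hg (fun x => not_iff_not.1 (hp x))

theorem glue_reattach (τ : FPFI L) (D : Diagram L) (π : Equiv.Perm D.HalfEdge)
    (hπ : ∀ s, π (D.leg s) = D.leg s) (π' : Equiv.Perm (D.glue τ).HalfEdge)
    (hπ' : ∀ x, (π' x).1 = π x.1) :
    Iso ((D.reattach π).glue τ) ((D.glue τ).reattach π') := by
  have hn : ∀ h, D.next h = h → π h = h := by
    intro h hh
    obtain ⟨s, rfl⟩ := (D.next_eq_iff h).1 hh
    exact hπ s
  have hp : ∀ a, D.next (π a) ≠ π a ↔ D.next a ≠ a := by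
    intro a
    rw [not_iff_not]
    constructor
    · intro h
      have := π.injective (hn _ h)
      rwa [this] at h
    · intro h
      rwa [hn _ h]
  have hg : ∀ a, π (D.legInv τ a) = D.legInv τ (π a) := by
    intro a
    by_cases ha : D.next a = a
    · obtain ⟨s, rfl⟩ := (D.next_eq_iff a).1 ha
      rw [legInv_leg, hπ, hπ, legInv_leg]
    · rw [legInv_of_next_ne _ _ _ ha, legInv_of_next_ne _ _ _ ((hp a).2 ha)]
  refine ⟨Equiv.refl _, fun _ => rfl, ?_, fun s => s.elim, ?_⟩
  · intro x
    have hc : ∀ a, π ((π⁻¹ * D.flip * π) a) = D.flip (π a) := fun a => by simp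
    have h := firstReturn_map (ρ := (π⁻¹ * D.flip * π) * D.legInv τ)
      (ρ' := D.flip * D.legInv τ) (p := fun h => D.next h ≠ h) (q := fun h => D.next h ≠ h) π
      (fun a => by rw [Equiv.Perm.mul_apply, hc, hg, Equiv.Perm.mul_apply]) hp x
    change firstReturn ((π⁻¹ * D.flip * π) * D.legInv τ) (fun h => D.next h ≠ h) x =
      π'⁻¹ (firstReturn (D.flip * D.legInv τ) (fun h => D.next h ≠ h) (π' x))
    have hx : π' x = ⟨π x.1, (hp _).2 x.2⟩ := Subtype.ext (hπ' x)
    refine Eq.symm (Equiv.Perm.inv_eq_iff_eq.2 ?_)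
    refine ((congrArg (firstReturn (D.flip * D.legInv τ) (fun h => D.next h ≠ h)) hx).trans
      h).trans ?_
    exact Subtype.ext (hπ' _).symm
  · change D.loops + _ = D.loops + _
    congr 1
    refine card_circles_congr π (fun x => ?_) hg (fun x => not_iff_not.1 (hp x))
    change π ((π⁻¹ * D.flip * π) x) = D.flip (π x)
    simp

theorem glue_flip_of_next_ne (τ : FPFI L) (D : Diagram L) (x : (D.glue τ).HalfEdge)
    (hx : D.next (D.flip x.1) ≠ D.flip x.1) : (D.glue τ).flip x = ⟨D.flip x.1, hx⟩ := by
  refine firstReturn_eq 0 ?_ (fun j hj => absurd hj (Nat.not_lt_zero j))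
  rw [zero_add, pow_one, Equiv.Perm.mul_apply, legInv_of_next_ne _ _ _ x.2]

theorem leg_ne {D : Diagram L} {h : D.HalfEdge} (hh : D.next h ≠ h) (s : L) : D.leg s ≠ h :=
  fun e => hh ((D.next_eq_iff h).2 ⟨s, e⟩)

theorem isLocal_glue (τ : FPFI L) : IsLocal (fun D : Diagram L => D.glue τ) where
  iso D D' h := glue_iso τ h
  as D h hh := by
    classical
    have h2 := next_next_ne hh
    refine ⟨⟨h, hh⟩, fun e => hh (congrArg Subtype.val e), glue_reattach τ D _ ?_ _ ?_⟩
    · intro s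
      exact Equiv.swap_apply_of_ne_of_ne (leg_ne h2 s) (leg_ne (next_next_ne h2) s)
    · intro x
      exact (map_swap Subtype.val Subtype.val_injective _ _ _).symm
  ihx D h hh := by
    classical
    obtain ⟨h1, h2, h3, h4⟩ := hh
    have k1 := next_next_ne h1
    have k2 := next_next_ne k1
    have k3 := next_next_ne h2
    let x₀ : (D.glue τ).HalfEdge := ⟨h, h1⟩
    have hf : (D.glue τ).flip x₀ = ⟨D.flip h, h2⟩ := glue_flip_of_next_ne τ D x₀ h2
    have key : ∀ x, ((D.glue τ).ihxPerm x₀ x).1 = D.ihxPerm h x.1 := by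
      intro x
      unfold ihxPerm
      rw [hf]
      exact (map_swap_swap Subtype.val Subtype.val_injective _ _ _ _ _).symm
    have hl : ∀ s, D.ihxPerm h (D.leg s) = D.leg s := by
      intro s
      rw [ihxPerm, Equiv.Perm.mul_apply,
        Equiv.swap_apply_of_ne_of_ne (leg_ne k2 s) (leg_ne k3 s),
        Equiv.swap_apply_of_ne_of_ne (leg_ne k1 s) (leg_ne k2 s)]
    refine ⟨x₀, ⟨fun e => h1 (congrArg Subtype.val e), ?_, ?_, ?_⟩,
      glue_reattach τ D _ hl _ key, glue_reattach τ D _ ?_ _ ?_⟩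
    · rw [hf]
      exact fun e => h2 (congrArg Subtype.val e)
    · rw [hf]
      exact fun e => h3 (congrArg Subtype.val e)
    · rw [hf]
      exact fun e => h4 (congrArg Subtype.val e)
    · intro s
      rw [Equiv.Perm.inv_eq_iff_eq, hl]
    · intro x
      rw [Equiv.Perm.eq_inv_iff_eq, ← key]
      simp

end Diagram
/-! ### Products and degrees of diagrams -/

namespace Diagram

variable {L L' : Type}

/-- Disjoint union with a closed diagram. -/
def act (D : Diagram Empty) (E : Diagram L) : Diagram L :=
  (D.sqcup E).relabel (Equiv.emptySum Empty L)

theorem act_comm (D E : Diagram Empty) : Iso (D.act E) (E.act D) := by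
  refine ⟨Equiv.sumComm _ _, ?_, ?_, fun s => s.elim, Nat.add_comm _ _⟩
  · rintro (x | x) <;> rfl
  · rintro (x | x) <;> rfl

theorem act_assoc (D D' : Diagram Empty) (E : Diagram L) :
    Iso ((D.act D').act E) (D.act (D'.act E)) := by
  refine ⟨Equiv.sumAssoc _ _ _, ?_, ?_, fun s => rfl, Nat.add_assoc _ _ _⟩
  · rintro ((x | x) | x) <;> rfl
  · rintro ((x | x) | x) <;> rfl

theorem empty_act (E : Diagram L) : Iso (empty.act E) E := by
  refine ⟨Equiv.emptySum Empty _, ?_, ?_, fun s => rfl, Nat.zero_add _⟩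
  · rintro (x | x)
    · exact x.elim
    · rfl
  · rintro (x | x)
    · exact x.elim
    · rfl

theorem act_sqcup (D : Diagram Empty) (E : Diagram L) (F : Diagram L') :
    Iso ((D.act E).sqcup F) (D.act (E.sqcup F)) := by
  refine ⟨Equiv.sumAssoc _ _ _, ?_, ?_, ?_, Nat.add_assoc _ _ _⟩
  · rintro ((x | x) | x) <;> rfl
  · rintro ((x | x) | x) <;> rfl
  · rintro (s | s) <;> rfl

theorem act_glue (τ : FPFI L) (D : Diagram Empty) (E : Diagram L) :
    Iso (D.act (E.glue τ)) ((D.act E).glue τ) := by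
  have hD : ∀ x, D.next x ≠ x := by
    intro x hx
    obtain ⟨s, -⟩ := (D.next_eq_iff x).1 hx
    exact s.elim
  have hn : ∀ x, (D.act E).next (Sum.inl x) ≠ Sum.inl x := fun x e => hD x (Sum.inl_injective e)
  have hp : ∀ x, (D.act E).next (Sum.inr x) ≠ Sum.inr x ↔ E.next x ≠ x := fun x =>
    not_congr ⟨fun e => Sum.inr_injective e, fun e => congrArg Sum.inr e⟩
  have hl : ∀ x, (D.act E).legInv τ (Sum.inl x) = Sum.inl x := fun x =>
    legInv_of_next_ne _ _ _ (hn x)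
  have hr : ∀ x, (D.act E).legInv τ (Sum.inr x) = Sum.inr (E.legInv τ x) := by
    intro x
    by_cases hx : E.next x = x
    · obtain ⟨s, rfl⟩ := (E.next_eq_iff x).1 hx
      rw [legInv_leg]
      exact legInv_leg (D.act E) τ s
    · rw [legInv_of_next_ne _ _ _ hx]
      exact legInv_of_next_ne _ _ _ ((hp x).2 hx)
  let e : D.HalfEdge ⊕ {x // E.next x ≠ x} ≃
      {x : D.HalfEdge ⊕ E.HalfEdge // (D.act E).next x ≠ x} :=
    { toFun := Sum.elim (fun x => ⟨Sum.inl x, hn x⟩) (fun x => ⟨Sum.inr x.1, (hp _).2 x.2⟩)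
      invFun := fun x => match x with
        | ⟨Sum.inl x, _⟩ => Sum.inl x
        | ⟨Sum.inr x, h⟩ => Sum.inr ⟨x, (hp x).1 h⟩
      left_inv := by rintro (x | x) <;> rfl
      right_inv := by rintro ⟨x | x, h⟩ <;> rfl }
  refine ⟨e, ?_, ?_, fun s => s.elim, ?_⟩
  · rintro (x | x) <;> rfl
  · rintro (x | x)
    · exact (glue_flip_of_next_ne τ (D.act E) ⟨Sum.inl x, hn x⟩ (hn _)).symm
    · exact (firstReturn_map (ρ := E.flip * E.legInv τ)
        (ρ' := (D.act E).flip * (D.act E).legInv τ) (p := fun h => E.next h ≠ h)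
        (q := fun h => (D.act E).next h ≠ h) Sum.inr
        (fun a => (congrArg (D.act E).flip (hr a)).symm) hp x).symm
  · change D.loops + (E.loops + _) = D.loops + E.loops + _
    rw [← Nat.add_assoc]
    congr 1
    let r := fun x y : E.HalfEdge => y = E.flip x ∨ y = E.legInv τ x
    let r' := fun x y : (D.act E).HalfEdge => y = (D.act E).flip x ∨ y = (D.act E).legInv τ x
    have hr' : ∀ x y, r x y → r' (Sum.inr x) (Sum.inr y) := by
      rintro x y (h | h)
      · exact Or.inl (congrArg Sum.inr h)
      · exact Or.inr ((congrArg Sum.inr h).trans (hr x).symm)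
    -- a section up to the components of `D`
    let f : (D.act E).HalfEdge → Option (Quot r) :=
      Sum.elim (fun _ => none) (fun x => some (Quot.mk r x))
    have hf : ∀ x y, r' x y → f x = f y := by
      rintro (x | x) (y | y) (h | h)
      · rfl
      · rfl
      · cases h
      · rw [hl] at h; cases h
      · cases h
      · rw [hr] at h; cases h
      · exact congrArg some (Quot.sound (Or.inl (Sum.inr_injective h)))
      · rw [hr] at h
        exact congrArg some (Quot.sound (Or.inr (Sum.inr_injective h)))
    let G : Quot r' → Option (Quot r) := Quot.lift f hf
    let F : Quot r → Quot r' := Quot.lift (fun x => Quot.mk r' (Sum.inr x))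
      (fun x y h => Quot.sound (hr' x y h))
    have hGF : ∀ c, G (F c) = some c := by rintro ⟨x⟩; rfl
    have hFG : ∀ x c, f x = some c → Quot.mk r' x = F c := by
      rintro (x | x) c h
      · cases h
      · cases h; rfl
    refine Nat.card_congr (Equiv.ofBijective
      (fun c => ⟨F c.1, ?_⟩ : {c : Quot r // ∀ h, Quot.mk r h = c → E.next h = h} →
        {c : Quot r' // ∀ h, Quot.mk r' h = c → (D.act E).next h = h}) ⟨?_, ?_⟩)
    · intro x hx
      have h1 : f x = some c.1 := by rw [← hGF, ← hx]
      rcases x with x | x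
      · cases h1
      · exact congrArg Sum.inr (c.2 x (Option.some_injective _ h1))
    · intro c c' h
      have h1 := congrArg G (congrArg Subtype.val h)
      exact Subtype.ext (Option.some_injective _ ((hGF _).symm.trans (h1.trans (hGF _))))
    · rintro ⟨⟨x | x⟩, h⟩
      · exact absurd (h _ rfl) (hn x)
      · refine ⟨⟨Quot.mk r x, fun y hy => ?_⟩, rfl⟩
        exact Sum.inr_injective (h (Sum.inr y) (congrArg F hy))

theorem three_dvd (D : Diagram L) : 3 ∣ Nat.card {h // D.next h ≠ h} := by
  classical
  have := Fintype.ofFinite {h // D.next h ≠ h}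
  let f : Function.End {h // D.next h ≠ h} :=
    (D.next.subtypePerm (p := fun h => D.next h ≠ h) (by simp) : _ → _)
  have : Fact (Nat.Prime 3) := ⟨Nat.prime_three⟩
  have hf : f ^ 3 ^ 1 = 1 := by
    funext x
    exact Subtype.ext (D.next_next_next x.1)
  have h := Equiv.Perm.card_fixedPoints_modEq hf
  have h0 : Fintype.card f.fixedPoints = 0 := by
    rw [Fintype.card_eq_zero_iff]
    exact ⟨fun x => x.1.2 (congrArg Subtype.val x.2)⟩
  rw [h0] at h
  rw [Nat.card_eq_fintype_card]
  exact (Nat.modEq_zero_iff_dvd).1 h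

theorem three_mul_numTrivalent (D : Diagram L) :
    3 * D.numTrivalent = Nat.card {h // D.next h ≠ h} := Nat.mul_div_cancel' D.three_dvd

theorem card_halfEdge (D : Diagram L) :
    Nat.card D.HalfEdge = Nat.card {h // D.next h ≠ h} + Nat.card L := by
  classical
  have h1 : Nat.card L = Nat.card {h // ¬ D.next h ≠ h} := by
    refine Nat.card_congr (Equiv.ofBijective
      (fun s => ⟨D.leg s, not_not.2 ((D.next_eq_iff _).2 ⟨s, rfl⟩)⟩) ⟨?_, ?_⟩)
    · exact fun s t h => D.leg_injective (congrArg Subtype.val h)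
    · rintro ⟨h, hh⟩
      obtain ⟨s, rfl⟩ := (D.next_eq_iff h).1 (not_not.1 hh)
      exact ⟨s, rfl⟩
  rw [h1, ← Nat.card_sum]
  exact Nat.card_congr (Equiv.sumCompl _).symm

theorem even_card_halfEdge (D : Diagram L) : 2 ∣ Nat.card D.HalfEdge := by
  classical
  have := Fintype.ofFinite D.HalfEdge
  let f : Function.End D.HalfEdge := (D.flip : _ → _)
  have : Fact (Nat.Prime 2) := ⟨Nat.prime_two⟩
  have hf : f ^ 2 ^ 1 = 1 := by
    funext x
    exact D.flip_flip x
  have h := Equiv.Perm.card_fixedPoints_modEq hf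
  have h0 : Fintype.card f.fixedPoints = 0 := by
    rw [Fintype.card_eq_zero_iff]
    exact ⟨fun x => D.flip_ne x.1 x.2⟩
  rw [h0] at h
  rw [Nat.card_eq_fintype_card]
  exact (Nat.modEq_zero_iff_dvd).1 h

theorem two_mul_degree (D : Diagram L) : 2 * D.degree = D.numTrivalent + Nat.card L := by
  have h1 := D.three_mul_numTrivalent
  have h2 := D.card_halfEdge
  have h3 := D.even_card_halfEdge
  unfold degree
  omega

theorem numTrivalent_sqcup (D : Diagram L) (E : Diagram L') :
    (D.sqcup E).numTrivalent = D.numTrivalent + E.numTrivalent := by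
  have h : Nat.card {h // (D.sqcup E).next h ≠ h} =
      Nat.card {h // D.next h ≠ h} + Nat.card {h // E.next h ≠ h} := by
    rw [← Nat.card_sum]
    refine Nat.card_congr (Equiv.trans (Equiv.subtypeSum (α := D.HalfEdge) (β := E.HalfEdge))
      (Equiv.sumCongr (Equiv.subtypeEquivRight fun x => ?_)
        (Equiv.subtypeEquivRight fun x => ?_)))
    · exact not_congr Sum.inl_injective.eq_iff
    · exact not_congr Sum.inr_injective.eq_iff
  have h1 := (D.sqcup E).three_mul_numTrivalent
  have h2 := D.three_mul_numTrivalent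
  have h3 := E.three_mul_numTrivalent
  omega

theorem numTrivalent_glue (τ : FPFI L) (D : Diagram L) :
    (D.glue τ).numTrivalent = D.numTrivalent := by
  have h : Nat.card {h // (D.glue τ).next h ≠ h} = Nat.card {h // D.next h ≠ h} :=
    Nat.card_congr (Equiv.subtypeUnivEquiv fun x e => x.2 (congrArg Subtype.val e))
  unfold numTrivalent
  rw [h]

theorem degree_act (D : Diagram Empty) (E : Diagram L) :
    (D.act E).degree = D.degree + E.degree := by
  have h1 := (D.act E).two_mul_degree
  have h2 := D.two_mul_degree
  have h3 := E.two_mul_degree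
  have h4 : (D.act E).numTrivalent = D.numTrivalent + E.numTrivalent := numTrivalent_sqcup D E
  have h5 : Nat.card Empty = 0 := by simp
  omega

theorem degree_pair (D E : Diagram L) :
    ((D.sqcup E).glue (FPFI.exchange L)).degree + Nat.card L = D.degree + E.degree := by
  have h1 := ((D.sqcup E).glue (FPFI.exchange L)).two_mul_degree
  have h2 := D.two_mul_degree
  have h3 := E.two_mul_degree
  rw [numTrivalent_glue, numTrivalent_sqcup] at h1
  have h5 : Nat.card Empty = 0 := by simp
  omega

theorem numTrivalent_of_next_eq (D : Diagram L) (h : ∀ x, D.next x = x) :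
    D.numTrivalent = 0 := by
  have : IsEmpty {x // D.next x ≠ x} := ⟨fun x => x.2 (h _)⟩
  simp [numTrivalent]

theorem degree_empty : empty.degree = 0 := by
  simp [degree, numTrivalent_of_next_eq empty fun x => x.elim]

theorem degree_loop : loop.degree = 0 := by
  simp [degree, numTrivalent_of_next_eq loop fun x => x.elim]

theorem degree_strut [Finite L] (τ : FPFI L) : (strut τ).degree = Nat.card L / 2 := by
  simp [degree, numTrivalent_of_next_eq (strut τ) fun _ => rfl]

end Diagram
/-! ### Spaces of Jacobi diagrams -/

/-- Isomorphism classes of Jacobi diagrams with free legs `L`. -/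
abbrev Jac (L : Type) : Type 1 := Quotient (Diagram.setoid L)

/-- The basis vector of `ℂ Jac(L)` given by a diagram. -/
noncomputable def basisVec {L : Type} (D : Diagram L) : Jac L →₀ ℂ :=
  Finsupp.single (Quotient.mk _ D : Jac L) 1

/-- The relations AS (the reversal of the cyclic order at a trivalent vertex is `-1`) and IHX
(the sum over the cyclic permutations of three of the four edges adjacent to an edge between two
trivalent vertices vanishes). -/
inductive IsRelation {L : Type} : (Jac L →₀ ℂ) → Prop
  | as (D : Diagram L) (h : D.HalfEdge) (hh : D.next h ≠ h) :
      IsRelation (basisVec D + basisVec (D.reattach (D.asPerm h)))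
  | ihx (D : Diagram L) (h : D.HalfEdge) (hh : D.IsInnerEdge h) :
      IsRelation (basisVec D + basisVec (D.reattach (D.ihxPerm h)) +
        basisVec (D.reattach (D.ihxPerm h)⁻¹))

/-- The span of the relations. -/
noncomputable def relSpan (L : Type) : Submodule ℂ (Jac L →₀ ℂ) := Submodule.span ℂ {r | IsRelation r}

/-- The space of Jacobi diagrams with free legs `L` modulo AS and IHX. -/
def Space (L : Type) : Type 1 := (Jac L →₀ ℂ) ⧸ relSpan L

noncomputable instance (L : Type) : AddCommGroup (Space L) :=
  inferInstanceAs (AddCommGroup ((Jac L →₀ ℂ) ⧸ relSpan L))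

noncomputable instance (L : Type) : Module ℂ (Space L) :=
  inferInstanceAs (Module ℂ ((Jac L →₀ ℂ) ⧸ relSpan L))

namespace Space

variable {L L' : Type}

/-- The projection `ℂ Jac(L) → Space L`. -/
noncomputable def proj (L : Type) : (Jac L →₀ ℂ) →ₗ[ℂ] Space L := (relSpan L).mkQ

/-- The class of a Jacobi diagram. -/
noncomputable def cls (D : Diagram L) : Space L := proj L (basisVec D)

theorem cls_eq_of_iso {D E : Diagram L} (h : D.Iso E) : cls D = cls E := by
  have : (Quotient.mk _ D : Jac L) = Quotient.mk _ E := Quotient.sound h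
  simp only [cls, basisVec, this]

theorem proj_relation {r : Jac L →₀ ℂ} (h : IsRelation r) : proj L r = 0 :=
  (Submodule.Quotient.mk_eq_zero _).2 (Submodule.subset_span h)

theorem cls_as (D : Diagram L) (h : D.HalfEdge) (hh : D.next h ≠ h) :
    cls D + cls (D.reattach (D.asPerm h)) = 0 := by
  have := proj_relation (IsRelation.as D h hh)
  simpa only [map_add, cls] using this

theorem cls_ihx (D : Diagram L) (h : D.HalfEdge) (hh : D.IsInnerEdge h) :
    cls D + cls (D.reattach (D.ihxPerm h)) + cls (D.reattach (D.ihxPerm h)⁻¹) = 0 := by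
  have := proj_relation (IsRelation.ihx D h hh)
  simpa only [map_add, cls] using this

theorem hom_ext {M : Type*} [AddCommMonoid M] [Module ℂ M] {f g : Space L →ₗ[ℂ] M}
    (h : ∀ D, f (cls D) = g (cls D)) : f = g := by
  have h1 : f.comp (proj L) = g.comp (proj L) := by
    refine Finsupp.lhom_ext' fun J => LinearMap.ext_ring ?_
    induction J using Quotient.inductionOn with
    | h D => exact h D
  refine LinearMap.ext fun x => ?_
  obtain ⟨v, rfl⟩ := (relSpan L).mkQ_surjective x
  exact congrArg (fun F => F v) h1

/-- A function on diagrams that respects isomorphisms and the relations. -/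
structure IsInvariant {M : Type*} [AddCommGroup M] [Module ℂ M] (f : Diagram L → M) : Prop where
  iso : ∀ D D', D.Iso D' → f D = f D'
  as : ∀ (D : Diagram L) (h : D.HalfEdge), D.next h ≠ h →
    f D + f (D.reattach (D.asPerm h)) = 0
  ihx : ∀ (D : Diagram L) (h : D.HalfEdge), D.IsInnerEdge h →
    f D + f (D.reattach (D.ihxPerm h)) + f (D.reattach (D.ihxPerm h)⁻¹) = 0

/-- The linear map induced by an invariant function on diagrams. -/
noncomputable def lift {M : Type*} [AddCommGroup M] [Module ℂ M] (f : Diagram L → M)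
    (hf : IsInvariant f) : Space L →ₗ[ℂ] M :=
  (relSpan L).liftQ (Finsupp.linearCombination ℂ (Quotient.lift f hf.iso : Jac L → M)) <| by
    have hb : ∀ D : Diagram L, Finsupp.linearCombination ℂ
        (Quotient.lift f hf.iso : Jac L → M) (basisVec D) = f D := by
      intro D
      rw [basisVec, Finsupp.linearCombination_single, one_smul]
      rfl
    refine Submodule.span_le.2 ?_
    rintro r (⟨D, h, hh⟩ | ⟨D, h, hh⟩)
    · change Finsupp.linearCombination ℂ _ _ = 0
      rw [map_add, hb, hb, hf.as D h hh]
    · change Finsupp.linearCombination ℂ _ _ = 0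
      rw [map_add, map_add, hb, hb, hb, hf.ihx D h hh]

@[simp]
theorem lift_cls {M : Type*} [AddCommGroup M] [Module ℂ M] (f : Diagram L → M)
    (hf : IsInvariant f) (D : Diagram L) : lift f hf (cls D) = f D := by
  change Finsupp.linearCombination ℂ (Quotient.lift f hf.iso : Jac L → M) (basisVec D) = f D
  rw [basisVec, Finsupp.linearCombination_single, one_smul]
  rfl

theorem isInvariant_of_isLocal {F : Diagram L → Diagram L'} (hF : Diagram.IsLocal F) :
    IsInvariant (fun D => cls (F D)) where
  iso D D' h := cls_eq_of_iso (hF.iso D D' h)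
  as D h hh := by
    obtain ⟨h', hh', hi⟩ := hF.as D h hh
    rw [cls_eq_of_iso hi]
    exact cls_as _ _ hh'
  ihx D h hh := by
    obtain ⟨h', hh', hi, hi'⟩ := hF.ihx D h hh
    rw [cls_eq_of_iso hi, cls_eq_of_iso hi']
    exact cls_ihx _ _ hh'

/-- The bilinear map induced by the disjoint union. -/
noncomputable def sqcup : Space L →ₗ[ℂ] Space L' →ₗ[ℂ] Space (L ⊕ L') :=
  lift (fun D => lift (fun E => cls (D.sqcup E))
      (isInvariant_of_isLocal (Diagram.isLocal_sqcup_right D)))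
    { iso := fun D D' h => hom_ext fun E => by
        simpa only [lift_cls] using
          (isInvariant_of_isLocal (Diagram.isLocal_sqcup_left E)).iso D D' h
      as := fun D h hh => hom_ext fun E => by
        simpa only [LinearMap.add_apply, LinearMap.zero_apply, lift_cls] using
          (isInvariant_of_isLocal (Diagram.isLocal_sqcup_left E)).as D h hh
      ihx := fun D h hh => hom_ext fun E => by
        simpa only [LinearMap.add_apply, LinearMap.zero_apply, lift_cls] using
          (isInvariant_of_isLocal (Diagram.isLocal_sqcup_left E)).ihx D h hh }

@[simp]
theorem sqcup_cls (D : Diagram L) (E : Diagram L') : sqcup (cls D) (cls E) = cls (D.sqcup E) := by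
  simp [sqcup]

/-- The linear map induced by a renaming of the legs. -/
noncomputable def relabel (e : L ≃ L') : Space L →ₗ[ℂ] Space L' :=
  lift (fun D => cls (D.relabel e)) (isInvariant_of_isLocal (Diagram.isLocal_relabel e))

@[simp]
theorem relabel_cls (e : L ≃ L') (D : Diagram L) : relabel e (cls D) = cls (D.relabel e) := by
  simp [relabel]

/-- The linear map induced by the gluing of legs. -/
noncomputable def glue (τ : FPFI L) : Space L →ₗ[ℂ] Space Empty :=
  lift (fun D => cls (D.glue τ)) (isInvariant_of_isLocal (Diagram.isLocal_glue τ))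

@[simp]
theorem glue_cls (τ : FPFI L) (D : Diagram L) : glue τ (cls D) = cls (D.glue τ) := by
  simp [glue]

/-- The action of closed diagrams by disjoint union. -/
noncomputable def act : Space Empty →ₗ[ℂ] Space L →ₗ[ℂ] Space L :=
  sqcup.compr₂ (relabel (Equiv.emptySum Empty L))

@[simp]
theorem act_cls (D : Diagram Empty) (E : Diagram L) : act (cls D) (cls E) = cls (D.act E) := by
  simp [act, Diagram.act]

/-- The pairing `⟨x, y⟩` which glues the legs of `x` to the legs of `y` with the same label. -/
noncomputable def pair : Space L →ₗ[ℂ] Space L →ₗ[ℂ] Space Empty :=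
  sqcup.compr₂ (glue (FPFI.exchange L))

@[simp]
theorem pair_cls (D E : Diagram L) :
    pair (cls D) (cls E) = cls ((D.sqcup E).glue (FPFI.exchange L)) := by
  simp [pair]

theorem act_assoc (x y : Space Empty) (z : Space L) : act (act x y) z = act x (act y z) := by
  have h : (act (L := Empty)).compr₂ (act (L := L)) =
      (LinearMap.llcomp ℂ (Space L) (Space L) (Space L)).compl₁₂ act act := by
    refine hom_ext fun D => hom_ext fun D' => hom_ext fun E => ?_
    simpa using cls_eq_of_iso (Diagram.act_assoc D D' E)
  exact congrArg (fun f => f x y z) h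

theorem act_comm (x y : Space Empty) : act x y = act y x := by
  have h : act (L := Empty) = (act (L := Empty)).flip := by
    refine hom_ext fun D => hom_ext fun D' => ?_
    simpa using cls_eq_of_iso (Diagram.act_comm D D')
  exact congrArg (fun f => f x y) h

theorem empty_act (x : Space L) : act (cls Diagram.empty) x = x := by
  have h : act (L := L) (cls Diagram.empty) = LinearMap.id := by
    refine hom_ext fun D => ?_
    simpa using cls_eq_of_iso (Diagram.empty_act D)
  exact congrArg (fun f => f x) h

theorem act_pair (x : Space Empty) (y z : Space L) : act x (pair y z) = pair (act x y) z := by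
  have h : (LinearMap.llcomp ℂ (Space L) (Space Empty) (Space Empty)).compl₁₂
        (act (L := Empty)) ((pair (L := L)).flip) =
      (LinearMap.llcomp ℂ (Space L) (Space L) (Space Empty)).flip.compl₁₂
        (act (L := L)) ((pair (L := L)).flip) := by
    refine hom_ext fun D => hom_ext fun F => hom_ext fun E => ?_
    simpa using cls_eq_of_iso ((Diagram.act_glue _ D (E.sqcup F)).trans
      (Diagram.glue_iso _ (Diagram.act_sqcup D E F).symm))
  exact congrArg (fun f => f x z y) h

/-- The commutative algebra of closed Jacobi diagrams, with the disjoint union as product. -/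
noncomputable instance : CommRing (Space Empty) :=
  { (inferInstance : AddCommGroup (Space Empty)) with
    mul := fun x y => act x y
    one := cls Diagram.empty
    mul_assoc := act_assoc
    mul_comm := act_comm
    one_mul := empty_act
    mul_one := fun x => (act_comm x _).trans (empty_act x)
    zero_mul := fun x => by change act 0 x = 0; simp
    mul_zero := fun x => by change act x 0 = 0; simp
    left_distrib := fun x y z => by change act x (y + z) = act x y + act x z; simp
    right_distrib := fun x y z => by change act (x + y) z = act x z + act y z; simp }

noncomputable instance : Algebra ℂ (Space Empty) :=
  Algebra.ofModule (fun r x y => by change act (r • x) y = r • act x y; simp)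
    (fun r x y => by change act x (r • y) = r • act x y; simp)

theorem mul_def (x y : Space Empty) : x * y = act x y := rfl

theorem one_def : (1 : Space Empty) = cls Diagram.empty := rfl

/-- The part of degree `d`. -/
noncomputable def gr (L : Type) (d : ℕ) : Submodule ℂ (Space L) :=
  Submodule.span ℂ {x | ∃ D : Diagram L, D.degree = d ∧ x = cls D}

theorem cls_mem_gr (D : Diagram L) : cls D ∈ gr L D.degree :=
  Submodule.subset_span ⟨D, rfl, rfl⟩

theorem gr_induction {L : Type} {d : ℕ} {p : Space L → Prop} (h : ∀ D, D.degree = d → p (cls D))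
    (h0 : p 0) (hadd : ∀ x y, p x → p y → p (x + y)) (hsmul : ∀ (r : ℂ) x, p x → p (r • x))
    {x : Space L} (hx : x ∈ gr L d) : p x := by
  refine Submodule.span_induction ?_ h0 (fun x y _ _ => hadd x y) (fun r x _ => hsmul r x) hx
  rintro x ⟨D, hD, rfl⟩
  exact h D hD

theorem act_mem_gr {i j : ℕ} {x : Space Empty} {y : Space L} (hx : x ∈ gr Empty i)
    (hy : y ∈ gr L j) : act x y ∈ gr L (i + j) := by
  refine gr_induction (p := fun x => act x y ∈ gr L (i + j)) (fun D hD => ?_) (by simp)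
    (fun x x' h h' => by simpa using add_mem h h')
    (fun r x h => by simpa using Submodule.smul_mem _ r h) hx
  refine gr_induction (p := fun y => act (cls D) y ∈ gr L (i + j)) (fun E hE => ?_) (by simp)
    (fun x x' h h' => by simpa using add_mem h h')
    (fun r x h => by simpa using Submodule.smul_mem _ r h) hy
  rw [act_cls, ← hD, ← hE, ← Diagram.degree_act]
  exact cls_mem_gr _

theorem pair_mem_gr {i j m : ℕ} (hm : i + j = m + Nat.card L) {x y : Space L}
    (hx : x ∈ gr L i) (hy : y ∈ gr L j) : pair x y ∈ gr Empty m := by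
  refine gr_induction (p := fun x => pair x y ∈ gr Empty m) (fun D hD => ?_) (by simp)
    (fun x x' h h' => by simpa using add_mem h h')
    (fun r x h => by simpa using Submodule.smul_mem _ r h) hx
  refine gr_induction (p := fun y => pair (cls D) y ∈ gr Empty m) (fun E hE => ?_) (by simp)
    (fun x x' h h' => by simpa using add_mem h h')
    (fun r x h => by simpa using Submodule.smul_mem _ r h) hy
  have h := Diagram.degree_pair D E
  have : m = ((D.sqcup E).glue (FPFI.exchange L)).degree := by omega
  rw [pair_cls, this]
  exact cls_mem_gr _

/-- The sum of the classes of all diagrams consisting of `k` struts on the legs `1, …, 2k`. -/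
noncomputable def strutSum (k : ℕ) : Space (Fin (2 * k)) :=
  ∑ τ : FPFI (Fin (2 * k)), cls (Diagram.strut τ)

theorem strutSum_mem_gr (k : ℕ) : strutSum k ∈ gr (Fin (2 * k)) k := by
  refine Submodule.sum_mem _ fun τ _ => ?_
  have h := cls_mem_gr (Diagram.strut τ)
  rw [Diagram.degree_strut, Nat.card_fin, Nat.mul_div_cancel_left k two_pos] at h
  exact h

end Space
/-! ### Degree completions -/

open PowerSeries

/-- The degree completion of the space of Jacobi diagrams with free legs `L`, as the product of its
homogeneous parts. -/
noncomputable def Completion (L : Type) : Submodule ℂ (ℕ → Space L) :=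
  Submodule.pi Set.univ (Space.gr L)

/-- The degree completion of the algebra of closed Jacobi diagrams: the formal series
`∑ₘ xₘ tᵐ` with `xₘ` homogeneous of degree `m`. -/
noncomputable def ClosedCompletion : Subalgebra ℂ (Space Empty)⟦X⟧ where
  carrier := {f | ∀ m, coeff m f ∈ Space.gr Empty m}
  mul_mem' := by
    intro f g hf hg m
    rw [coeff_mul]
    refine Submodule.sum_mem _ fun ij hij => ?_
    have h := Space.act_mem_gr (hf ij.1) (hg ij.2)
    rwa [Finset.HasAntidiagonal.mem_antidiagonal.1 hij] at h
  add_mem' := by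
    intro f g hf hg m
    rw [map_add]
    exact add_mem (hf m) (hg m)
  algebraMap_mem' := by
    intro r m
    rw [PowerSeries.algebraMap_apply, coeff_C]
    split_ifs with h
    · subst h
      rw [Algebra.algebraMap_eq_smul_one, Space.one_def]
      have h := Space.cls_mem_gr Diagram.empty
      rw [Diagram.degree_empty] at h
      exact Submodule.smul_mem _ r h
    · exact zero_mem _

/-- The pairing of the completions induced by `Space.pair`. The degree is shifted by the number of
legs, which disappear. -/
noncomputable def completedPair {L : Type} (x y : Completion L) : ClosedCompletion :=
  ⟨PowerSeries.mk fun m => ∑ ij ∈ Finset.HasAntidiagonal.antidiagonal (m + Nat.card L),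
      Space.pair (x.1 ij.1) (y.1 ij.2), by
    intro m
    rw [coeff_mk]
    exact Submodule.sum_mem _ fun ij hij =>
      Space.pair_mem_gr (Finset.HasAntidiagonal.mem_antidiagonal.1 hij) (x.2 _ trivial) (y.2 _ trivial)⟩

/-- `Space.strutSum k` as an element of the completion. -/
noncomputable def completedStrutSum (k : ℕ) : Completion (Fin (2 * k)) :=
  ⟨Pi.single k (Space.strutSum k), by
    intro d _
    by_cases h : d = k
    · subst h
      rw [Pi.single_eq_same]
      exact Space.strutSum_mem_gr d
    · rw [Pi.single_eq_of_ne h]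
      exact zero_mem _⟩

theorem coeff_completedPair_strutSum (k m : ℕ) (x : Completion (Fin (2 * k))) :
    coeff m (completedPair x (completedStrutSum k)).1 =
      Space.pair (x.1 (m + k)) (Space.strutSum k) := by
  unfold completedPair
  rw [coeff_mk, Nat.card_fin, Finset.sum_eq_single (m + k, k)]
  · simp [completedStrutSum]
  · rintro ⟨i, j⟩ hij hne
    have hj : j ≠ k := by
      rintro rfl
      rw [Finset.HasAntidiagonal.mem_antidiagonal] at hij
      exact hne (by ext <;> simp; omega)
    simp [completedStrutSum, Pi.single_eq_of_ne hj]
  · intro h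
    exact absurd (Finset.HasAntidiagonal.mem_antidiagonal.2 (by simp; omega)) h

theorem exists_completedPair_iff (k : ℕ) (f : ClosedCompletion) :
    (∃ x : Completion (Fin (2 * k)), completedPair x (completedStrutSum k) = f) ↔
      ∀ m, ∃ x ∈ Space.gr (Fin (2 * k)) (m + k), Space.pair x (Space.strutSum k) = coeff m f.1 := by
  constructor
  · rintro ⟨x, rfl⟩ m
    exact ⟨x.1 (m + k), x.2 _ trivial, (coeff_completedPair_strutSum k m x).symm⟩
  · intro h
    choose x hx hxf using h
    let y : Completion (Fin (2 * k)) := ⟨fun d => if k ≤ d then x (d - k) else 0, by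
      intro d _
      by_cases hd : k ≤ d
      · have := hx (d - k)
        rw [Nat.sub_add_cancel hd] at this
        simpa [hd] using this
      · simp [hd]⟩
    refine ⟨y, Subtype.ext (PowerSeries.ext fun m => ?_)⟩
    rw [coeff_completedPair_strutSum, ← hxf]
    simp [y]

/-- The ideal of all pairings `⟨x, ς⟩`, where `ς` is the sum of all systems of `k` struts on `2k`
legs and `x` runs over the completed space of Jacobi diagrams with `2k` legs. -/
noncomputable def strutIdeal (k : ℕ) : Ideal ClosedCompletion where
  carrier := {f | ∃ x : Completion (Fin (2 * k)), completedPair x (completedStrutSum k) = f}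
  zero_mem' := by
    change ∃ x, _
    rw [exists_completedPair_iff]
    exact fun m => ⟨0, zero_mem _, by simp⟩
  add_mem' := by
    intro f g hf hg
    change ∃ x, _ at hf hg ⊢
    rw [exists_completedPair_iff] at hf hg ⊢
    intro m
    obtain ⟨x, hx, hxf⟩ := hf m
    obtain ⟨y, hy, hyg⟩ := hg m
    exact ⟨x + y, add_mem hx hy, by simp [hxf, hyg]⟩
  smul_mem' := by
    intro f g hg
    change ∃ x, _ at hg ⊢
    rw [exists_completedPair_iff] at hg ⊢
    intro m
    choose x hx hxg using hg
    refine ⟨∑ ij ∈ Finset.HasAntidiagonal.antidiagonal m, Space.act (coeff ij.1 f.1) (x ij.2),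
      Submodule.sum_mem _ fun ij hij => ?_, ?_⟩
    · have h := Space.act_mem_gr (f.2 ij.1) (hx ij.2)
      rwa [← add_assoc, Finset.HasAntidiagonal.mem_antidiagonal.1 hij] at h
    · change _ = coeff m (f.1 * g.1)
      rw [coeff_mul, map_sum, LinearMap.sum_apply]
      refine Finset.sum_congr rfl fun ij _ => ?_
      rw [← Space.act_pair, hxg, Space.mul_def]

/-- The ideal of the elements whose components of degree `≤ n` vanish. -/
noncomputable def degreeAbove (n : ℕ) : Ideal ClosedCompletion where
  carrier := {f | ∀ m ≤ n, coeff m f.1 = 0}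
  zero_mem' := fun m _ => by simp
  add_mem' := fun {f g} hf hg m hm => by simp [hf m hm, hg m hm]
  smul_mem' := fun f g hg m hm => by
    change coeff m (f.1 * g.1) = 0
    rw [coeff_mul]
    refine Finset.sum_eq_zero fun ij hij => ?_
    have := Finset.HasAntidiagonal.mem_antidiagonal.1 hij
    rw [hg ij.2 (by omega), mul_zero]

/-- The closure of an ideal in the topology defined by the degree, for which the ideals
`degreeAbove N` form a basis of neighbourhoods of zero. -/
noncomputable def degreeClosure (I : Ideal ClosedCompletion) : Ideal ClosedCompletion :=
  ⨅ N : ℕ, I ⊔ degreeAbove N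

/-- The class of the dashed loop. -/
noncomputable def dashedLoop : ClosedCompletion :=
  ⟨C (Space.cls Diagram.loop), by
    intro m
    rw [coeff_C]
    split_ifs with h
    · subst h
      have h := Space.cls_mem_gr Diagram.loop
      rwa [Diagram.degree_loop] at h
    · exact zero_mem _⟩

/-- The closed ideal generated by the sum of the dashed loop and `2n`. -/
noncomputable def loopIdeal (n : ℕ) : Ideal ClosedCompletion :=
  degreeClosure (Ideal.span {dashedLoop + 2 * (n : ClosedCompletion)})

/-- The elements which are homogeneous of degree `m`. -/
noncomputable def homogeneousPart (m : ℕ) : Submodule ℂ ClosedCompletion where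
  carrier := {f | ∀ d, d ≠ m → coeff d f.1 = 0}
  zero_mem' := fun d _ => by simp
  add_mem' := fun {f g} hf hg d hd => by simp [hf d hd, hg d hd]
  smul_mem' := fun r f hf d hd => by simp [hf d hd]

/-- The algebra `𝔠(n)`. -/
abbrev CAlg (n : ℕ) : Type 1 := ClosedCompletion ⧸ (strutIdeal (n + 1) ⊔ loopIdeal n)

/-- The algebra `𝔡(n)`. -/
abbrev DAlg (n : ℕ) : Type 1 :=
  ClosedCompletion ⧸ (strutIdeal (n + 1) ⊔ loopIdeal n ⊔ degreeAbove n)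

/-- The canonical projection `𝔠(n) → 𝔡(n)`. -/
noncomputable def pr (n : ℕ) : CAlg n →ₐ[ℂ] DAlg n := Ideal.Quotient.factorₐ ℂ le_sup_left

/-- The degree `m` part of the quotient by `strutIdeal k`. -/
noncomputable def strutQuotientPart (k m : ℕ) : Submodule ℂ (ClosedCompletion ⧸ strutIdeal k) :=
  (homogeneousPart m).map (Ideal.Quotient.mkₐ ℂ (strutIdeal k)).toLinearMap

end Jacobi

namespace Jacobi

/-! ### Functions on matchings with the symmetries of diagrams -/

section Matchings

open Equiv

/-! Everything reduces to one claim: modulo pairings with `strutSum 2`, every closed diagram with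
more than two vertices vanishes. Pairing with `strutSum 2` means cutting two edges and summing over
the three ways to reglue the four ends. The quotient therefore satisfies, besides AS and IHX, the
relation that this three-term sum is zero. Vertices can be kept fixed throughout while only the
matching of half-edges varies; `IsWeight` records the relations in that form.

Three local consequences carry the argument. A tadpole vanishes by AS. IHX combined with the
three-term relation turns an inner edge that is not doubled into a combination of two diagrams in
which it is doubled (`resolve_edge`). A double edge with distinct outer ends splits off as a theta
component with factor -1/2, because turning the bubble around is an isomorphism (`resolve_bubble`).

Hence every weight reduces to diagrams with a theta component and a further vertex. Such a diagram T
is killed by computing one diagram G in two ways: G carries the bubble on an edge at the further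
vertex. Splitting off the bubble gives G = -T/2. Resolving the edge between the bubble and that
vertex gives 3G + G₁ + G₂ = 0, where G₁ and G₂ also contain a bubble and equal -T/2. So 5T/2 = 0
(`eq_zero_of_theta_planar`).

A closed diagram of degree m has 2m vertices, so the claim applies exactly from degree 2 on. Thus
`degreeAbove 1` lies in `strutIdeal 2`, and all assertions follow; the loop relation plays no role.
-/

/-- The matching obtained from `τ` by exchanging the edge ends at `a` and `b`. -/
def swapEnds {H : Type} [DecidableEq H] (τ : Perm H) (a b : H) : Perm H :=
  swap a b * τ * swap a b

/-- A fixed-point free involution. -/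
structure IsMatching {H : Type} (τ : Perm H) : Prop where
  invol : ∀ x, τ (τ x) = x
  ne : ∀ x, τ x ≠ x

/-- A function of the edges of a graph with fixed oriented trivalent vertices (the cycles of `n`)
which is invariant under isomorphisms and satisfies AS, IHX and the vanishing of the sum over the
three ways to glue four edge ends. -/
structure IsWeight {H : Type} {M : Type*} [DecidableEq H] [AddCommGroup M] (n : Perm H)
    (F : Perm H → M) : Prop where
  n3 : ∀ h, n (n (n h)) = h
  n_ne : ∀ h, n h ≠ h
  iso : ∀ τ κ, IsMatching τ → (∀ h, κ (n h) = n (κ h)) → F (κ * τ * κ⁻¹) = F τ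
  as : ∀ τ h, IsMatching τ → F τ + F (swapEnds τ (n h) (n (n h))) = 0
  ihx : ∀ τ h, IsMatching τ → τ h ≠ n h → τ h ≠ n (n h) →
    F τ + F ((swap (n h) (n (n h)) * swap (n (n h)) (n (τ h)))⁻¹ * τ *
      (swap (n h) (n (n h)) * swap (n (n h)) (n (τ h)))) +
    F ((swap (n h) (n (n h)) * swap (n (n h)) (n (τ h))) * τ *
      (swap (n h) (n (n h)) * swap (n (n h)) (n (τ h)))⁻¹) = 0
  -- These are the three pairings of `a, τ a, c, τ c`: the second joins `a` to `τ c`, the third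
  -- joins `a` to `c`.
  strut : ∀ τ a c, IsMatching τ → c ≠ a → c ≠ τ a →
    F τ + F (swapEnds τ a c) + F (swapEnds τ a (τ c)) = 0

/-! ### Matchings and exchanges of edge ends -/

variable {H : Type} {τ : Perm H}

namespace IsMatching

theorem mul_self (h : IsMatching τ) : τ * τ = 1 := Equiv.ext h.invol

theorem inv_eq (h : IsMatching τ) : τ⁻¹ = τ := inv_eq_of_mul_eq_one_left h.mul_self

theorem apply_eq_iff (h : IsMatching τ) {x y : H} : τ x = y ↔ x = τ y :=
  ⟨fun e => by rw [← e, h.invol], fun e => by rw [e, h.invol]⟩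

/-- Permuting ends on one side of some edges has the same effect as the inverse permutation on the
opposite sides: since `τ * π = κ * τ`, both conjugates equal `π⁻¹ * κ * τ` once `π` and `κ` commute.
-/
theorem conj_eq_conj (hτ : IsMatching τ) {π κ : Perm H} (h : κ = τ * π * τ)
    (hc : Commute π κ) : π⁻¹ * τ * π = κ * τ * κ⁻¹ := by
  have hτ' := hτ.mul_self
  have e1 : τ * π = κ * τ := by rw [h, mul_assoc, hτ', mul_one]
  have e2 : τ * κ⁻¹ = π⁻¹ * τ := by
    rw [h, mul_inv_rev, mul_inv_rev, hτ.inv_eq, ← mul_assoc, ← mul_assoc, hτ', one_mul]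
  rw [mul_assoc, e1, mul_assoc κ, e2, ← mul_assoc, ← mul_assoc, hc.inv_left.eq]

end IsMatching

variable [DecidableEq H]

theorem swapEnds_apply (τ : Perm H) (a b x : H) :
    swapEnds τ a b x = swap a b (τ (swap a b x)) := rfl

theorem swapEnds_swapEnds (τ : Perm H) (a b : H) : swapEnds (swapEnds τ a b) a b = τ := by
  ext x; simp [swapEnds_apply]

theorem swap_commute {a b c d : H} (h1 : a ≠ c) (h2 : a ≠ d) (h3 : b ≠ c) (h4 : b ≠ d) :
    Commute (swap a b) (swap c d) := by
  refine Equiv.ext fun x => ?_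
  simp only [Perm.mul_apply, swap_apply_def]
  grind

namespace IsMatching

theorem swapEnds (h : IsMatching τ) (a b : H) : IsMatching (swapEnds τ a b) where
  invol x := by simp [swapEnds_apply, h.invol]
  ne x := by
    rw [swapEnds_apply, Ne, swap_apply_eq_iff]
    exact h.ne _

theorem swapEnds_self (h : IsMatching τ) {a b : H} (e : τ a = b) : Jacobi.swapEnds τ a b = τ := by
  subst e
  have h1 : swap a (τ a) * τ = τ * swap a (τ a) := by
    rw [mul_swap_eq_swap_mul, h.invol, swap_comm]
  rw [Jacobi.swapEnds, h1, mul_assoc, swap_mul_self, mul_one]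

end IsMatching

/-! ### Local consequences of AS, IHX and the three-term relation -/

namespace IsWeight

variable {M : Type*} [AddCommGroup M] {n : Perm H} {F : Perm H → M}

theorem as' (hF : IsWeight n F) (hτ : IsMatching τ) (h : H) : F τ + F (swapEnds τ h (n h)) = 0 := by
  have := hF.as τ (n (n h)) hτ
  rwa [hF.n3] at this

theorem nn_ne (hF : IsWeight n F) (h : H) : n (n h) ≠ h := fun e => by
  have := hF.n3 h
  rw [e] at this
  exact hF.n_ne h this

/-- Exchanging the two ends of an edge does not change the matching, so AS at the vertex of the
tadpole reads `2 F τ = 0`. -/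
theorem eq_zero_of_tadpole [Module ℂ M] (hF : IsWeight n F) (hτ : IsMatching τ) {x : H} (hx : τ x = n x) : F τ = 0 := by
  have h := hF.as' hτ x
  rw [hτ.swapEnds_self hx] at h
  linear_combination (norm := module) (1 / 2 : ℂ) • h

/-- The exchange of the vertices of `a` and `c`. -/
def _root_.Jacobi.swapVertices (n : Perm H) (a c : H) : Perm H :=
  swap a c * (swap (n a) (n c) * swap (n (n a)) (n (n c)))

theorem swapVertices_comm (hF : IsWeight n F) {a c : H} (h0 : c ≠ a) (h1 : c ≠ n a)
    (h2 : c ≠ n (n a)) (x : H) : swapVertices n a c (n x) = n (swapVertices n a c x) := by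
  have n3 := hF.n3
  have n1 := hF.n_ne
  have n2 := hF.nn_ne
  have hi : ∀ x y, n x = n y ↔ x = y := fun x y => n.injective.eq_iff
  simp only [swapVertices, Perm.mul_apply, swap_apply_def]
  grind

theorem swapVertices_conj (hF : IsWeight n F) (hτ : IsMatching τ) {a c : H} (h0 : c ≠ a)
    (h1 : c ≠ n a) (h2 : c ≠ n (n a)) :
    F (swapVertices n a c * τ * (swapVertices n a c)⁻¹) = F τ :=
  hF.iso _ _ hτ (hF.swapVertices_comm h0 h1 h2)

/-- The exchange of the vertices of `a` and `c` that reverses the orientations. -/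
def _root_.Jacobi.reflectVertices (n : Perm H) (a c : H) : Perm H :=
  swap a c * (swap (n (n a)) (n c) * swap (n a) (n (n c)))

variable [Module ℂ M]

/-- The IHX relation expressed by exchanges of edge ends. -/
theorem ihx_swapEnds (hF : IsWeight n F) (hτ : IsMatching τ) {x y : H} (hxy : τ x = y) (h1 : y ≠ n x)
    (h2 : y ≠ n (n x)) :
    F τ = F (swapEnds τ (n x) (n y)) + F (swapEnds τ (n (n x)) (n y)) := by
  subst hxy
  have h := hF.ihx τ x hτ h1 h2
  set u := n x
  set w := n u
  set v := n (τ x)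
  have huw : u ≠ w := (hF.n_ne u).symm
  have huv : u ≠ v := fun e => hτ.ne x (n.injective e).symm
  have hwv : w ≠ v := fun e => h1 (n.injective e).symm
  -- The 3-cycle of IHX is factored so that each conjugation becomes one exchange of an end with
  -- `v`, followed by the exchange of `u` and `w`. The latter is an AS move at the vertex of `x` and
  -- contributes the sign.
  have e1 : swap u w * swap w v = swap u v * swap u w := by
    refine Equiv.ext fun z => ?_
    simp only [Perm.mul_apply, swap_apply_def]
    grind
  have e2 : (swap u w * swap w v)⁻¹ = swap w v * swap u w := by
    simp [mul_inv_rev]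
  have a1 := hF.as _ x (hτ.swapEnds u v)
  have a2 := hF.as _ x (hτ.swapEnds w v)
  have e3 : (swap u w * swap w v)⁻¹ * τ * (swap u w * swap w v) =
      swapEnds (swapEnds τ u v) u w := by
    rw [e1, mul_inv_rev, swap_inv, swap_inv]
    simp only [swapEnds, mul_assoc]
  have e4 : (swap u w * swap w v) * τ * (swap u w * swap w v)⁻¹ =
      swapEnds (swapEnds τ w v) u w := by
    rw [e2]
    simp only [swapEnds, mul_assoc]
  rw [e3, e4] at h
  change F (swapEnds τ u v) + F (swapEnds (swapEnds τ u v) u w) = 0 at a1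
  change F (swapEnds τ w v) + F (swapEnds (swapEnds τ w v) u w) = 0 at a2
  linear_combination (norm := module) (1 : ℂ) • h - (1 : ℂ) • a1 - (1 : ℂ) • a2

/-- Resolution of an inner edge that is not part of a double edge. -/
theorem resolve_edge (hF : IsWeight n F) (hτ : IsMatching τ) {x y : H} (hxy : τ x = y) (h1 : y ≠ n x)
    (h2 : y ≠ n (n x)) (h3 : τ (n y) ≠ n x) (h4 : τ (n y) ≠ n (n x)) :
    (3 : ℂ) • F τ + F (swapEnds τ (n x) (τ (n y))) + F (swapEnds τ (n (n x)) (τ (n y))) = 0 := by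
  have h := hF.ihx_swapEnds hτ hxy h1 h2
  have hyx : y ≠ x := hxy ▸ hτ.ne x
  -- Each of the two IHX terms is replaced by minus the other two gluings of the same four ends.
  -- This leaves two more copies of `F τ` and two diagrams in which `n y` is joined to the vertex of
  -- `x`, so that the edge `x y` becomes double.
  have s1 := hF.strut τ (n x) (n y) hτ (fun e => hyx (n.injective e))
    (fun e => h3 (hτ.apply_eq_iff.2 e))
  have s2 := hF.strut τ (n (n x)) (n y) hτ (fun e => h1 (n.injective e))
    (fun e => h4 (hτ.apply_eq_iff.2 e))
  linear_combination (norm := module) (1 : ℂ) • s1 + (1 : ℂ) • s2 + (1 : ℂ) • h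

/-- A reflection is the orientation-preserving exchange of the vertices composed with an AS move at
each of them, and the two signs cancel. -/
theorem reflectVertices_conj (hF : IsWeight n F) (hτ : IsMatching τ) {a c : H} (h0 : c ≠ a)
    (h1 : c ≠ n a) (h2 : c ≠ n (n a)) :
    F (reflectVertices n a c * τ * (reflectVertices n a c)⁻¹) = F τ := by
  have n3 := hF.n3
  have n1 := hF.n_ne
  have n2 := hF.nn_ne
  have hi : ∀ x y, n x = n y ↔ x = y := fun x y => n.injective.eq_iff
  have e : reflectVertices n a c =
      swapVertices n a c * (swap (n a) (n (n a)) * swap (n c) (n (n c))) := by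
    refine Equiv.ext fun x => ?_
    simp only [swapVertices, reflectVertices, Perm.mul_apply, swap_apply_def]
    grind
  have h := hF.swapVertices_conj ((hτ.swapEnds (n c) (n (n c))).swapEnds (n a) (n (n a))) h0 h1 h2
  have a1 := hF.as τ c hτ
  have a2 := hF.as _ a (hτ.swapEnds (n c) (n (n c)))
  have e' : reflectVertices n a c * τ * (reflectVertices n a c)⁻¹ = swapVertices n a c *
      Jacobi.swapEnds (Jacobi.swapEnds τ (n c) (n (n c))) (n a) (n (n a)) *
        (swapVertices n a c)⁻¹ := by
    rw [e]
    simp only [Jacobi.swapEnds, mul_inv_rev, swap_inv, mul_assoc]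
  rw [e', h]
  linear_combination (norm := module) (1 : ℂ) • a2 - (1 : ℂ) • a1

/-- The two swaps carry the pair of edges `p q`, `r s` to itself, so of the whole conjugation only
the exchange of `a` and `c` remains. With these edges forming a bubble, turning the bubble around is
thus the same as exchanging its outer ends. -/
theorem conj_eq (hτ : IsMatching τ) {a c p q r s : H}
    (h1 : τ p = q) (h2 : τ r = s) (hpq : Commute (swap p s) (swap r q)) :
    (swap a c * (swap p s * swap r q)) * τ * (swap a c * (swap p s * swap r q))⁻¹ =
      swapEnds τ a c := by
  have h3 : τ * swap p s = swap q r * τ := by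
    rw [mul_swap_eq_swap_mul, h1, hτ.apply_eq_iff.2 h2.symm]
  have h4 : τ * swap q r = swap p s * τ := by
    rw [mul_swap_eq_swap_mul, ← h1, hτ.invol, h2]
  rw [swap_comm r q] at *
  simp only [swapEnds, mul_inv_rev, swap_inv, mul_assoc]
  congr 1
  rw [← mul_assoc τ (swap q r), h4, mul_assoc (swap p s), ← mul_assoc τ, h3]
  simp only [← mul_assoc]
  congr 1
  rw [hpq.eq, mul_assoc (swap q r), swap_mul_self, mul_one, swap_mul_self, one_mul]

/-- Removal of a double edge between the vertices of `a` and `c`. -/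
theorem resolve_bubble (hF : IsWeight n F) (hτ : IsMatching τ) {a c : H} (h0 : c ≠ a)
    (h1 : c ≠ n a) (h2 : c ≠ n (n a)) (hac : τ a ≠ c)
    (hb : (τ (n a) = n (n c) ∧ τ (n (n a)) = n c) ∨ (τ (n a) = n c ∧ τ (n (n a)) = n (n c))) :
    (2 : ℂ) • F τ + F (swapEnds τ a (τ c)) = 0 := by
  have n3 := hF.n3
  have n1 := hF.n_ne
  have n2 := hF.nn_ne
  have hi : ∀ x y, n x = n y ↔ x = y := fun x y => n.injective.eq_iff
  have s := hF.strut τ a c hτ h0 (Ne.symm hac)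
  -- Two of the three gluings agree: exchanging the outer ends of the bubble is an isomorphism, a
  -- translation or a reflection according to how the double edge is attached. The third gluing
  -- joins `a` to `c` and closes the bubble to a theta component.
  suffices h : F (swapEnds τ a c) = F τ by
    linear_combination (norm := module) (1 : ℂ) • s - (1 : ℂ) • h
  rcases hb with ⟨b1, b2⟩ | ⟨b1, b2⟩
  · rw [← hF.swapVertices_conj hτ h0 h1 h2, swapVertices, conj_eq hτ b1 b2]
    exact swap_commute (by grind) (by grind) (by grind) (by grind)
  · rw [← hF.reflectVertices_conj hτ h0 h1 h2, reflectVertices, conj_eq hτ b2 b1]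
    exact swap_commute (by grind) (by grind) (by grind) (by grind)

/-- By `conj_eq_conj`, three exchanges of edge ends can be moved to the opposite ends of the same
edges. When these opposite ends are the half-edges of two vertices, the regluing becomes an exchange
of vertices. The hypothesis `hne` keeps the two groups of six half-edges disjoint, so that the
permutations commute. -/
theorem swapEnds_three (hτ : IsMatching τ) {a b d p q r a' b' d' p' q' r' : H}
    (ha : τ a = a') (hb : τ b = b') (hd : τ d = d') (hp : τ p = p') (hq : τ q = q')
    (hr : τ r = r')
    (hne : ∀ x ∈ [a, b, d, p, q, r], ∀ y ∈ [a', b', d', p', q', r'], x ≠ y) :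
    swapEnds (swapEnds (swapEnds τ a p) b q) d r =
      (swap a' p' * (swap b' q' * swap d' r')) * τ *
        (swap a' p' * (swap b' q' * swap d' r'))⁻¹ := by
  have hs : ∀ x y, τ * swap x y * τ = swap (τ x) (τ y) := fun x y => by
    rw [mul_swap_eq_swap_mul, mul_assoc, hτ.mul_self, mul_one]
  have hs' : ∀ (x y : H) (π : Perm H), τ * (swap x y * π) = swap (τ x) (τ y) * (τ * π) :=
    fun x y π => by rw [← mul_assoc, mul_swap_eq_swap_mul, mul_assoc]
  rw [← hτ.conj_eq_conj (π := swap a p * (swap b q * swap d r))]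
  · simp only [Jacobi.swapEnds, mul_inv_rev, swap_inv, mul_assoc]
  · rw [mul_assoc, mul_assoc, mul_assoc, hs', hs', ← mul_assoc τ, hs, ha, hb, hd, hp, hq, hr]
  · simp only [List.mem_cons, List.not_mem_nil, or_false, forall_eq_or_imp, forall_eq] at hne
    refine Commute.mul_left ?_ (Commute.mul_left ?_ ?_) <;>
      refine Commute.mul_right ?_ (Commute.mul_right ?_ ?_) <;>
      apply swap_commute <;> simp only [hne, ne_eq, not_false_eq_true]

/-! ### Vanishing of theta components, of bubbles and of all large diagrams -/

set_option maxHeartbeats 800000 in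
/-- A theta component vanishes in the presence of a further vertex. -/
theorem eq_zero_of_theta_planar (hF : IsWeight n F) (hτ : IsMatching τ) {a c w : H}
    (h0 : c ≠ a) (h1 : c ≠ n a) (h2 : c ≠ n (n a)) (b0 : τ a = c)
    (b1 : τ (n a) = n (n c)) (b2 : τ (n (n a)) = n c)
    (wa : w ≠ a ∧ w ≠ n a ∧ w ≠ n (n a)) (wc : w ≠ c ∧ w ≠ n c ∧ w ≠ n (n c)) : F τ = 0 := by
  have n3 := hF.n3
  have n1 := hF.n_ne
  have n2 := hF.nn_ne
  have hi : ∀ x y, n x = n y ↔ x = y := fun x y => n.injective.eq_iff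
  by_cases t0 : τ w = n w
  · exact hF.eq_zero_of_tadpole hτ t0
  by_cases t1 : τ (n w) = n (n w)
  · exact hF.eq_zero_of_tadpole hτ t1
  by_cases t2 : τ (n (n w)) = w
  · exact hF.eq_zero_of_tadpole hτ (t2.trans (n3 w).symm)
  have hinv := hτ.invol
  have hne := hτ.ne
  set p := τ w with hp
  set q := τ (n w) with hq
  set r := τ (n (n w)) with hr
  obtain ⟨wa0, wa1, wa2⟩ := wa
  obtain ⟨wc0, wc1, wc2⟩ := wc
  -- In `G` the edge `a c` of the theta component is merged with the edge `w p`: the double edge now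
  -- sits between `w` and `p`.
  set G := swapEnds τ a p with hG
  have mG : IsMatching G := hτ.swapEnds a p
  have Ga : G a = w := by grind [swapEnds_apply]
  have Gc : G c = p := by grind [swapEnds_apply]
  have Gna : G (n a) = n (n c) := by grind [swapEnds_apply]
  have Gnna : G (n (n a)) = n c := by grind [swapEnds_apply]
  have Gnw : G (n w) = q := by grind [swapEnds_apply]
  have Gnnw : G (n (n w)) = r := by grind [swapEnds_apply]
  have e1 := hF.resolve_bubble mG h0 h1 h2 (by grind) (Or.inl ⟨Gna, Gnna⟩)
  rw [Gc, hG, swapEnds_swapEnds, ← hG] at e1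
  -- The edge from the bubble to the further vertex is resolved. In both resulting diagrams the
  -- vertices of `a` and `w` share a double edge, and the vertex of `c` is joined to `p` and to one
  -- further end each of the vertex of `a` and the old neighbourhood of `w`.
  have e2 := hF.resolve_edge mG Ga wa1 wa2 (by grind) (by grind)
  rw [Gnw] at e2
  set G₁ := swapEnds G (n a) q with hG₁
  set G₂ := swapEnds G (n (n a)) q with hG₂
  have m₁ : IsMatching G₁ := mG.swapEnds _ _
  have m₂ : IsMatching G₂ := mG.swapEnds _ _
  have A₁ : G₁ a = w := by grind [swapEnds_apply]
  have B₁ : G₁ (n a) = n w := by grind [swapEnds_apply]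
  have C₁ : G₁ (n (n w)) = r := by grind [swapEnds_apply]
  have D₁ : G₁ (n (n a)) = n c := by grind [swapEnds_apply]
  have A₂ : G₂ a = w := by grind [swapEnds_apply]
  have B₂ : G₂ (n (n a)) = n w := by grind [swapEnds_apply]
  have C₂ : G₂ (n (n w)) = r := by grind [swapEnds_apply]
  have D₂ : G₂ (n a) = n (n c) := by grind [swapEnds_apply]
  -- The new bubble consists of `a w` and `n a n w`, so its outer ends are `n (n a)` and `n (n w)`.
  -- For `G₂` the outer ends are `n a` and `n (n w)`.
  have e3 := hF.resolve_bubble m₁ (a := n (n a)) (c := n (n w)) (by grind) (by grind) (by grind)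
    (by grind) (Or.inr ⟨by rw [n3, n3, A₁], by rw [n3, n3, B₁]⟩)
  have e4 := hF.resolve_bubble m₂ (a := n a) (c := n (n w)) (by grind) (by grind) (by grind)
    (by grind) (Or.inl ⟨by rw [n3, B₂], by rw [n3, n3, A₂]⟩)
  have hdisj : ∀ x ∈ [a, n a, n (n a), p, q, r], ∀ y ∈ [c, n c, n (n c), w, n w, n (n w)],
      x ≠ y := by
    simp only [List.mem_cons, List.not_mem_nil, or_false, forall_eq_or_imp, forall_eq]
    and_intros <;> grind only
  -- Splitting off the new bubble makes a theta component of the vertices of `a` and `w`, while the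
  -- vertex of `c` inherits `p, q, r`. This is the original diagram with the vertices of `c` and `w`
  -- exchanged: by a reflection here, and preserving orientations for `G₂`.
  have f3 : F (swapEnds G₁ (n (n a)) (G₁ (n (n w)))) = F τ := by
    rw [C₁, hG₁, hG, swapEnds_three hτ (a' := c) (p' := w) (b' := n (n c)) (q' := n w) (d' := n c)
      (r' := n (n w)) b0 b1 b2 (hinv w) (hinv _) (hinv _) (fun x hx y hy => hdisj x hx y (((List.Perm.swap _ _ _).cons _).subset hy))]
    exact hF.reflectVertices_conj hτ wc0 wc1 wc2
  have f4 : F (swapEnds G₂ (n a) (G₂ (n (n w)))) = F τ := by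
    rw [C₂, hG₂, hG, swapEnds_three hτ (a' := c) (p' := w) (b' := n c) (q' := n w)
      (d' := n (n c)) (r' := n (n w)) b0 b2 b1 (hinv w) (hinv _) (hinv _) (fun x hx => hdisj x (((List.Perm.swap _ _ _).cons _).subset hx))]
    exact hF.swapVertices_conj hτ wc0 wc1 wc2
  rw [f3] at e3
  rw [f4] at e4
  -- With `F G = F G₁ = F G₂ = -F τ / 2`, the relation `e2` says that `-5/2` times `F τ` is zero.
  linear_combination (norm := module) (-2 / 5 : ℂ) • e2 + (1 / 5 : ℂ) • e3 +
    (1 / 5 : ℂ) • e4 + (3 / 5 : ℂ) • e1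

/-- An AS move at `c` changes the second way of attaching the parallel edges into the planar one. -/
theorem eq_zero_of_theta (hF : IsWeight n F) (hτ : IsMatching τ) {a c w : H}
    (h0 : c ≠ a) (h1 : c ≠ n a) (h2 : c ≠ n (n a)) (b0 : τ a = c)
    (hb : (τ (n a) = n (n c) ∧ τ (n (n a)) = n c) ∨ (τ (n a) = n c ∧ τ (n (n a)) = n (n c)))
    (wa : w ≠ a ∧ w ≠ n a ∧ w ≠ n (n a)) (wc : w ≠ c ∧ w ≠ n c ∧ w ≠ n (n c)) : F τ = 0 := by
  rcases hb with ⟨b1, b2⟩ | ⟨b1, b2⟩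
  · exact hF.eq_zero_of_theta_planar hτ h0 h1 h2 b0 b1 b2 wa wc
  · have n3 := hF.n3
    have n1 := hF.n_ne
    have n2 := hF.nn_ne
    have hi : ∀ x y, n x = n y ↔ x = y := fun x y => n.injective.eq_iff
    have h := hF.as τ c hτ
    rwa [hF.eq_zero_of_theta_planar (hτ.swapEnds (n c) (n (n c))) h0 h1 h2
      (by grind [swapEnds_apply]) (by grind [swapEnds_apply]) (by grind [swapEnds_apply]) wa wc,
      add_zero] at h

/-- Either the outer ends are already joined and form a theta component, or splitting off the bubble
produces one. The vertex of `w` survives in both cases. -/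
theorem eq_zero_of_bubble (hF : IsWeight n F) (hτ : IsMatching τ) {a c w : H}
    (h0 : c ≠ a) (h1 : c ≠ n a) (h2 : c ≠ n (n a))
    (hb : (τ (n a) = n (n c) ∧ τ (n (n a)) = n c) ∨ (τ (n a) = n c ∧ τ (n (n a)) = n (n c)))
    (wa : w ≠ a ∧ w ≠ n a ∧ w ≠ n (n a)) (wc : w ≠ c ∧ w ≠ n c ∧ w ≠ n (n c)) : F τ = 0 := by
  by_cases hac : τ a = c
  · exact hF.eq_zero_of_theta hτ h0 h1 h2 hac hb wa wc
  · have n3 := hF.n3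
    have n1 := hF.n_ne
    have n2 := hF.nn_ne
    have hi : ∀ x y, n x = n y ↔ x = y := fun x y => n.injective.eq_iff
    have hinv := hτ.invol
    have hne := hτ.ne
    have h := hF.resolve_bubble hτ h0 h1 h2 hac hb
    rw [hF.eq_zero_of_theta (hτ.swapEnds a (τ c)) h0 h1 h2 (by grind [swapEnds_apply])
      (by grind [swapEnds_apply]) wa wc] at h
    linear_combination (norm := module) (1 / 2 : ℂ) • h

/-- A weight vanishes if there are more than two vertices. -/
theorem eq_zero (hF : IsWeight n F) (hτ : IsMatching τ) [Fintype H]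
    (hH : 6 < Fintype.card H) : F τ = 0 := by
  have n3 := hF.n3
  have n1 := hF.n_ne
  have n2 := hF.nn_ne
  have hi : ∀ x y, n x = n y ↔ x = y := fun x y => n.injective.eq_iff
  have hinv := hτ.invol
  have hne := hτ.ne
  by_cases ht : ∃ x, τ x = n x
  · obtain ⟨x, hx⟩ := ht
    exact hF.eq_zero_of_tadpole hτ hx
  have ht' : ∀ x, τ x ≠ n x := fun x hx => ht ⟨x, hx⟩
  obtain ⟨x⟩ : Nonempty H := Fintype.card_pos_iff.1 (by omega)
  -- The edge of `x` touches two vertices with at most six half-edges in all, so a further vertex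
  -- exists.
  obtain ⟨w, hw⟩ : ∃ w, w ∉ ({x, n x, n (n x), τ x, n (τ x), n (n (τ x))} : Finset H) := by
    by_contra! h
    have := Finset.card_le_card fun y (_ : y ∈ Finset.univ) => h y
    rw [Finset.card_univ] at this
    exact absurd (this.trans Finset.card_le_six) (by omega)
  simp only [Finset.mem_insert, Finset.mem_singleton, not_or] at hw
  obtain ⟨w1, w2, w3, w4, w5, w6⟩ := hw
  have hx1 := ht' x
  have hx2 := ht' (n (n x))
  rw [n3] at hx2
  have hx3 : τ x ≠ n (n x) := by grind
  -- If the edge of `x` is part of a double edge, the remaining half-edges of the two vertices are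
  -- the outer ends of a bubble. Otherwise `resolve_edge` reduces to this case.
  have key : ∀ σ, IsMatching σ → σ x = τ x →
      (σ (n (τ x)) = n x ∨ σ (n (τ x)) = n (n x)) → F σ = 0 := by
    rintro σ hσ h1 (h2 | h2)
    · have hinv' := hσ.invol
      exact hF.eq_zero_of_bubble hσ (a := n (n x)) (c := n (n (τ x))) (w := w) (by grind)
        (by grind) (by grind) (by grind) (by grind) (by grind)
    · have hinv' := hσ.invol
      exact hF.eq_zero_of_bubble hσ (a := n x) (c := n (n (τ x))) (w := w) (by grind)
        (by grind) (by grind) (by grind) (by grind) (by grind)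
  by_cases c1 : τ (n (τ x)) = n x
  · exact key τ hτ rfl (Or.inl c1)
  by_cases c2 : τ (n (τ x)) = n (n x)
  · exact key τ hτ rfl (Or.inr c2)
  have h := hF.resolve_edge hτ rfl hx1 hx3 c1 c2
  rw [key _ (hτ.swapEnds _ _) (by grind [swapEnds_apply]) (by grind [swapEnds_apply]),
    key _ (hτ.swapEnds _ _) (by grind [swapEnds_apply]) (by grind [swapEnds_apply])] at h
  linear_combination (norm := module) (1 / 3 : ℂ) • h

end IsWeight

end Matchings

end Jacobi

namespace Jacobi

/-! ### The sum over the three ways to glue four edge ends -/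

/-- This describes a glued edge that passes through a leg of a cut diagram and then through a strut
before it returns to a trivalent vertex. -/
theorem firstReturn_three {α : Type} [Finite α] {ρ : Equiv.Perm α} {p : α → Prop}
    {x y : Subtype p} {a b : α} (h1 : ρ x = a) (h2 : ρ a = b) (h3 : ρ b = y) (ha : ¬ p a)
    (hb : ¬ p b) : firstReturn ρ p x = y := by
  refine firstReturn_eq 2 ?_ fun j hj => ?_
  · rw [pow_succ, pow_succ, pow_one, Equiv.Perm.mul_apply, Equiv.Perm.mul_apply, h1, h2, h3]
  · obtain rfl | rfl : j = 0 ∨ j = 1 := by omega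
    · rwa [zero_add, pow_one, h1]
    · rwa [pow_succ, pow_one, Equiv.Perm.mul_apply, h1, h2]

namespace Diagram

variable {L : Type}

theorem isMatching_flip (D : Diagram L) : IsMatching D.flip := ⟨D.flip_flip, D.flip_ne⟩

/-- The graph with the same vertices and the edges given by `τ`. -/
def withFlip (D : Diagram L) (τ : Equiv.Perm D.HalfEdge) (hτ : IsMatching τ) : Diagram L :=
  { D with
    flip := τ
    flip_flip := hτ.invol
    flip_ne := hτ.ne }

theorem next_ne (D : Diagram Empty) (x : D.HalfEdge) : D.next x ≠ x := by
  intro hx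
  obtain ⟨s, -⟩ := (D.next_eq_iff x).1 hx
  exact s.elim

/-! ### Cutting edges and rejoining their ends -/

section Cut

variable {H L : Type} (τ : Equiv.Perm H) (pt : L → H)

open Classical in
/-- The involution which reconnects the points `pt i` according to `σ`. -/
noncomputable def joinFun (σ : L → L) (h : H) : H :=
  if hh : ∃ i, pt i = h then pt (σ hh.choose) else τ h

open Classical in
/-- The involution for which the edges ending at the points `pt i` are cut. -/
noncomputable def cutFun : H ⊕ L → H ⊕ L :=
  Sum.elim (fun h => if hh : ∃ i, pt i = h then Sum.inr hh.choose else Sum.inl (τ h))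
    (fun i => Sum.inl (pt i))

variable {τ pt}

theorem joinFun_pt (hpt : Function.Injective pt) (σ : L → L) (i : L) :
    joinFun τ pt σ (pt i) = pt (σ i) := by
  have h : ∃ j, pt j = pt i := ⟨i, rfl⟩
  rw [joinFun, dif_pos h, hpt h.choose_spec]

theorem joinFun_of_ne (σ : L → L) {h : H} (hh : ∀ i, pt i ≠ h) :
    joinFun τ pt σ h = τ h := dif_neg (by simpa using hh)

theorem cutFun_pt (hpt : Function.Injective pt) (i : L) :
    cutFun τ pt (Sum.inl (pt i)) = Sum.inr i := by
  have h : ∃ j, pt j = pt i := ⟨i, rfl⟩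
  rw [cutFun, Sum.elim_inl, dif_pos h, hpt h.choose_spec]

theorem cutFun_of_ne {h : H} (hh : ∀ i, pt i ≠ h) :
    cutFun τ pt (Sum.inl h) = Sum.inl (τ h) := dif_neg (by simpa using hh)

/-- Condition `hc` says that the marked points are all the ends of a set of edges. Hence `τ`
preserves their complement, and the new pairing does not interfere with the old one. -/
theorem joinFun_joinFun (hτ : IsMatching τ) (hpt : Function.Injective pt)
    (hc : ∀ i, ∃ j, pt j = τ (pt i)) (σ : FPFI L) (h : H) :
    joinFun τ pt σ.1 (joinFun τ pt σ.1 h) = h := by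
  by_cases hh : ∃ i, pt i = h
  · obtain ⟨i, rfl⟩ := hh
    rw [joinFun_pt hpt, joinFun_pt hpt, (σ.2 i).1]
  · push Not at hh
    rw [joinFun_of_ne _ hh, joinFun_of_ne, hτ.invol]
    intro i e
    obtain ⟨j, hj⟩ := hc i
    rw [e, hτ.invol] at hj
    exact hh j hj

theorem cutFun_cutFun (hτ : IsMatching τ) (hpt : Function.Injective pt)
    (hc : ∀ i, ∃ j, pt j = τ (pt i)) (h : H ⊕ L) : cutFun τ pt (cutFun τ pt h) = h := by
  rcases h with h | i
  · by_cases hh : ∃ i, pt i = h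
    · obtain ⟨i, rfl⟩ := hh
      rw [cutFun_pt hpt]
      rfl
    · push Not at hh
      rw [cutFun_of_ne hh, cutFun_of_ne, hτ.invol]
      intro i e
      obtain ⟨j, hj⟩ := hc i
      rw [e, hτ.invol] at hj
      exact hh j hj
  · exact cutFun_pt hpt i

theorem isMatching_joinFun (hτ : IsMatching τ) (hpt : Function.Injective pt)
    (hc : ∀ i, ∃ j, pt j = τ (pt i)) (σ : FPFI L) :
    IsMatching (Function.Involutive.toPerm _ (joinFun_joinFun hτ hpt hc σ)) where
  invol := joinFun_joinFun hτ hpt hc σ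
  ne h := by
    change joinFun τ pt σ.1 h ≠ h
    by_cases hh : ∃ i, pt i = h
    · obtain ⟨i, rfl⟩ := hh
      rw [joinFun_pt hpt]
      exact fun e => (σ.2 i).2 (hpt e)
    · push Not at hh
      rw [joinFun_of_ne _ hh]
      exact hτ.ne h

end Cut

variable [Finite L] (D : Diagram Empty) {τ : Equiv.Perm D.HalfEdge} {pt : L → D.HalfEdge}
  (hτ : IsMatching τ) (hpt : Function.Injective pt) (hc : ∀ i, ∃ j, pt j = τ (pt i))

/-- The diagram with the edges `τ`, cut at the points `pt i`. -/
noncomputable def cut : Diagram L where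
  HalfEdge := D.HalfEdge ⊕ L
  finite := inferInstance
  next := Equiv.Perm.sumCongr D.next 1
  next_next_next := by rintro (h | h) <;> simp [next_next_next]
  flip := Function.Involutive.toPerm _ (cutFun_cutFun hτ hpt hc)
  flip_flip := cutFun_cutFun hτ hpt hc
  flip_ne := by
    rintro (h | h)
    · change cutFun τ pt (Sum.inl h) ≠ Sum.inl h
      by_cases hh : ∃ i, pt i = h
      · obtain ⟨i, rfl⟩ := hh
        rw [cutFun_pt hpt]
        exact Sum.inr_ne_inl
      · push Not at hh
        rw [cutFun_of_ne hh]
        exact fun e => hτ.ne h (Sum.inl_injective e)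
    · exact Sum.inl_ne_inr
  leg := Sum.inr
  leg_injective := Sum.inr_injective
  next_eq_iff := by
    rintro (h | h)
    · simpa using D.next_ne h
    · simp
  loops := D.loops

/-- Cutting adds one univalent vertex for every marked point and leaves the trivalent vertices
unchanged. -/
theorem degree_cut : 2 * (D.cut hτ hpt hc).degree = 2 * D.degree + Nat.card L := by
  have h : (D.cut hτ hpt hc).numTrivalent = D.numTrivalent := by
    unfold numTrivalent
    congr 1
    refine Nat.card_congr (Equiv.ofBijective (fun x => ⟨Sum.inl x.1, ?_⟩) ⟨?_, ?_⟩ :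
      {h // D.next h ≠ h} ≃ {h // (D.cut hτ hpt hc).next h ≠ h}).symm
    · exact fun e => x.2 (Sum.inl_injective e)
    · exact fun x y e => Subtype.ext (Sum.inl_injective (congrArg Subtype.val e))
    · rintro ⟨x | x, hx⟩
      · exact ⟨⟨x, fun e => hx (congrArg Sum.inl e)⟩, rfl⟩
      · exact absurd rfl hx
  have h1 := D.two_mul_degree
  have h2 := (D.cut hτ hpt hc).two_mul_degree
  simp only [Nat.card_eq_fintype_card, Fintype.card_eq_zero] at h1
  omega

/-- Leg `i` hangs at `pt i` and the strut leads from `i` to `σ i`, so the glued edge runs from `pt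
i` to `pt (σ i)`. -/
theorem cut_glue (σ : FPFI L) :
    Iso (((D.cut hτ hpt hc).sqcup (strut σ)).glue (FPFI.exchange L))
      (D.withFlip _ (isMatching_joinFun hτ hpt hc σ)) := by
  set E := (D.cut hτ hpt hc).sqcup (strut σ)
  have hn : ∀ x : D.HalfEdge, E.next (Sum.inl (Sum.inl x)) ≠ Sum.inl (Sum.inl x) :=
    fun x e => D.next_ne x (Sum.inl_injective (Sum.inl_injective e))
  have hl : ∀ i : L, E.legInv (FPFI.exchange L) (Sum.inl (Sum.inr i)) = Sum.inr i :=
    fun i => legInv_leg E (FPFI.exchange L) (Sum.inl i)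
  have hr : ∀ i : L, E.legInv (FPFI.exchange L) (Sum.inr i) = Sum.inl (Sum.inr i) :=
    fun i => legInv_leg E (FPFI.exchange L) (Sum.inr i)
  have hi : ∀ x, E.legInv (FPFI.exchange L) (Sum.inl (Sum.inl x)) = Sum.inl (Sum.inl x) :=
    fun x => legInv_of_next_ne _ _ _ (hn x)
  have fp : ∀ i, E.flip (Sum.inl (Sum.inl (pt i))) = Sum.inl (Sum.inr i) :=
    fun i => congrArg Sum.inl (cutFun_pt hpt i)
  have fl : ∀ i, E.flip (Sum.inl (Sum.inr i)) = Sum.inl (Sum.inl (pt i)) := fun i => rfl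
  have fr : ∀ i, E.flip (Sum.inr i) = Sum.inr (σ.1 i) := fun i => rfl
  let e : D.HalfEdge ≃ (E.glue (FPFI.exchange L)).HalfEdge :=
    Equiv.ofBijective (fun x => ⟨Sum.inl (Sum.inl x), hn x⟩) ⟨fun x y h =>
      Sum.inl_injective (Sum.inl_injective (congrArg Subtype.val h)), by
        rintro ⟨(x | x) | x, hx⟩
        · exact ⟨x, rfl⟩
        · exact absurd rfl hx
        · exact absurd rfl hx⟩
  refine Iso.symm ⟨e, fun x => rfl, fun x => ?_, fun s => s.elim, ?_⟩
  · change e (joinFun τ pt σ.1 x) = _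
    symm
    by_cases hx : ∃ i, pt i = x
    · obtain ⟨i, rfl⟩ := hx
      rw [joinFun_pt hpt]
      exact firstReturn_three (ρ := E.flip * E.legInv (FPFI.exchange L))
        (p := fun h => E.next h ≠ h) (x := e (pt i)) (y := e (pt (σ.1 i)))
        ((congrArg E.flip (hi (pt i))).trans (fp i)) ((congrArg E.flip (hl i)).trans (fr i))
        ((congrArg E.flip (hr (σ.1 i))).trans (fl _)) (not_not.2 rfl) (not_not.2 rfl)
    · push Not at hx
      have hf : E.flip (Sum.inl (Sum.inl x)) = Sum.inl (Sum.inl (τ x)) :=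
        congrArg Sum.inl (cutFun_of_ne hx)
      rw [joinFun_of_ne _ hx]
      refine (glue_flip_of_next_ne (FPFI.exchange L) E (e x) ?_).trans (Subtype.ext hf)
      exact hf ▸ hn (τ x)
  · change D.loops = D.loops + 0 + _
    -- No new loop arises: every leg, of the cut diagram or of a strut, is connected to a half-edge
    -- at a trivalent vertex.
    rw [add_zero, Nat.left_eq_add, Nat.card_eq_zero]
    left
    refine ⟨?_⟩
    rintro ⟨⟨(x | i) | i⟩, h⟩
    · exact hn x (h _ rfl)
    · exact hn (pt i) (h _ (Quot.sound (Or.inl (fp i).symm)))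
    · refine hn (pt i) (h _ ?_)
      refine Eq.trans (b := Quot.mk _ (Sum.inl (Sum.inr i))) (Quot.sound ?_) (Quot.sound ?_)
      · exact Or.inl (fp i).symm
      · exact Or.inr (hl i).symm

end Diagram

end Jacobi

namespace Jacobi

/-! ### Closed diagrams of degree at least two -/

/-- The fixed-point free involution `(0 1)(2 3)`. -/
def FPFI.four₁ : FPFI (Fin 4) := ⟨Equiv.swap 0 1 * Equiv.swap 2 3, by decide⟩

/-- The fixed-point free involution `(0 3)(1 2)`. -/
def FPFI.four₂ : FPFI (Fin 4) := ⟨Equiv.swap 0 3 * Equiv.swap 1 2, by decide⟩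

/-- The fixed-point free involution `(0 2)(1 3)`. -/
def FPFI.four₃ : FPFI (Fin 4) := ⟨Equiv.swap 0 2 * Equiv.swap 1 3, by decide⟩

theorem FPFI.eq_four (σ : FPFI (Fin 4)) : σ = four₁ ∨ σ = four₂ ∨ σ = four₃ := by
  have h : ∀ σ : Equiv.Perm (Fin 4), (∀ s, σ (σ s) = s ∧ σ s ≠ s) →
      σ = four₁.1 ∨ σ = four₂.1 ∨ σ = four₃.1 := by decide
  exact (h σ.1 σ.2).imp Subtype.ext (Or.imp Subtype.ext Subtype.ext)

theorem FPFI.sum_four {M : Type*} [AddCommMonoid M] (g : FPFI (Fin 4) → M) :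
    ∑ σ, g σ = g four₁ + g four₂ + g four₃ := by
  classical
  have h12 : four₁ ≠ four₂ := fun e => absurd (congrArg Subtype.val e) (by decide)
  have h13 : four₁ ≠ four₃ := fun e => absurd (congrArg Subtype.val e) (by decide)
  have h23 : four₂ ≠ four₃ := fun e => absurd (congrArg Subtype.val e) (by decide)
  have h : (Finset.univ : Finset (FPFI (Fin 4))) = {four₁, four₂, four₃} := by
    ext σ
    simpa using eq_four σ
  rw [h, Finset.sum_insert (by simp [h12, h13]), Finset.sum_insert (by simp [h23]),
    Finset.sum_singleton, add_assoc]

/-! ### The weight of a closed diagram modulo pairings with struts -/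

namespace Space

/-- The pairings of homogeneous elements with the sum of all pairs of struts. -/
noncomputable def strutImage (m : ℕ) : Submodule ℂ (Space Empty) :=
  (gr (Fin (2 * 2)) (m + 2)).map ((pair (L := Fin (2 * 2))).flip (strutSum 2))

/-- Pairing the cut diagram, of degree `m + 2`, with `strutSum 2` reglues its four ends in all three
ways. This is the source of the three-term relation. -/
theorem sum_join_mem (D : Diagram Empty) {m : ℕ} (hD : D.degree = m)
    {τ : Equiv.Perm D.HalfEdge} {pt : Fin 4 → D.HalfEdge} (hτ : IsMatching τ)
    (hpt : Function.Injective pt) (hc : ∀ i, ∃ j, pt j = τ (pt i)) :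
    ∑ σ : FPFI (Fin 4), cls (D.withFlip _ (Diagram.isMatching_joinFun hτ hpt hc σ)) ∈
      strutImage m := by
  have h := D.degree_cut hτ hpt hc
  rw [Nat.card_fin] at h
  have h' : (D.cut hτ hpt hc).degree = m + 2 := by omega
  refine ⟨cls (D.cut hτ hpt hc), h' ▸ cls_mem_gr (L := Fin (2 * 2)) (D.cut hτ hpt hc), ?_⟩
  change pair (L := Fin 4) (cls (D.cut hτ hpt hc)) (∑ σ : FPFI (Fin 4), cls (Diagram.strut σ)) = _
  rw [map_sum]
  refine Finset.sum_congr rfl fun σ _ => ?_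
  rw [pair_cls]
  exact cls_eq_of_iso (D.cut_glue hτ hpt hc σ)

open Classical in
/-- The class of the diagram with the vertices of `D` and the edges `τ`, modulo the pairings with
the sum of all pairs of struts. -/
noncomputable def weight (D : Diagram Empty) (m : ℕ) (τ : Equiv.Perm D.HalfEdge) :
    Space Empty ⧸ strutImage m :=
  -- The default value is harmless, since the relations in `IsWeight` only concern matchings.
  if hτ : IsMatching τ then (strutImage m).mkQ (cls (D.withFlip τ hτ)) else 0

theorem weight_of_isMatching (D : Diagram Empty) (m : ℕ) {τ : Equiv.Perm D.HalfEdge}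
    (hτ : IsMatching τ) : weight D m τ = (strutImage m).mkQ (cls (D.withFlip τ hτ)) :=
  dif_pos hτ

theorem isMatching_conj {H : Type} {τ : Equiv.Perm H} (hτ : IsMatching τ) (π : Equiv.Perm H) :
    IsMatching (π * τ * π⁻¹) where
  invol x := by simp [hτ.invol]
  ne x := by
    rw [Equiv.Perm.mul_apply, Equiv.Perm.mul_apply, Ne, ← Equiv.Perm.eq_inv_iff_eq]
    exact hτ.ne _

theorem isMatching_conj' {H : Type} {τ : Equiv.Perm H} (hτ : IsMatching τ) (π : Equiv.Perm H) :
    IsMatching (π⁻¹ * τ * π) := by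
  simpa using isMatching_conj hτ π⁻¹

theorem weight_reattach (D : Diagram Empty) (m : ℕ) {τ : Equiv.Perm D.HalfEdge}
    (hτ : IsMatching τ) (π : Equiv.Perm D.HalfEdge) :
    (strutImage m).mkQ (cls ((D.withFlip τ hτ).reattach π)) = weight D m (π⁻¹ * τ * π) := by
  rw [weight_of_isMatching D m (isMatching_conj' hτ π)]
  rfl

open Classical in
theorem isWeight_weight (D : Diagram Empty) {m : ℕ} (hD : D.degree = m) :
    IsWeight D.next (weight D m) where
  n3 := D.next_next_next
  n_ne := D.next_ne
  iso τ κ hτ hκ := by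
    rw [weight_of_isMatching D m hτ, weight_of_isMatching D m (isMatching_conj hτ κ)]
    congr 1
    refine cls_eq_of_iso (Diagram.Iso.symm ⟨κ, hκ, fun h => ?_, fun s => s.elim, rfl⟩)
    exact congrArg (fun y => κ (τ y)) (κ.symm_apply_apply h).symm
  as τ h hτ := by
    have := congrArg (strutImage m).mkQ (cls_as (D.withFlip τ hτ) h (D.next_ne h))
    rw [map_add, map_zero] at this
    refine (congrArg₂ (· + ·) (weight_of_isMatching D m hτ) ?_).trans this
    refine Eq.trans ?_ (weight_reattach D m hτ (Equiv.swap (D.next h) (D.next (D.next h)))).symm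
    rw [Equiv.swap_inv]
    rfl
  ihx τ h hτ h1 h2 := by
    have := congrArg (strutImage m).mkQ (cls_ihx (D.withFlip τ hτ) h
      ⟨D.next_ne _, D.next_ne _, h1, h2⟩)
    rw [map_add, map_add, map_zero] at this
    refine (congrArg₂ (· + ·) (congrArg₂ (· + ·) (weight_of_isMatching D m hτ) ?_) ?_).trans this
    · exact (weight_reattach D m hτ _).symm
    · exact (weight_reattach D m hτ _).symm
  strut τ a c hτ hca hca' := by
    have h1 := hτ.ne
    have h2 := hτ.invol
    -- The three-term relation comes from cutting the edges of `a` and `c`, which are distinct by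
    -- `hca` and `hca'`.
    have hpt : Function.Injective ![a, τ a, c, τ c] := by
      intro i j h
      fin_cases i <;> fin_cases j <;> simp at h ⊢ <;> grind
    have hc : ∀ i, ∃ j, ![a, τ a, c, τ c] j = τ (![a, τ a, c, τ c] i) := by
      intro i
      fin_cases i
      · exact ⟨1, rfl⟩
      · exact ⟨0, (h2 a).symm⟩
      · exact ⟨3, rfl⟩
      · exact ⟨2, (h2 c).symm⟩
    have h := sum_join_mem D hD hτ hpt hc
    rw [← Submodule.Quotient.mk_eq_zero, ← Submodule.mkQ_apply, map_sum, FPFI.sum_four] at h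
    simp only [← weight_of_isMatching] at h
    -- A rejoined matching is recognised by its values at the four cut points. The involutions
    -- `four₁`, `four₂`, `four₃` join `a` to `τ a`, `τ c` and `c` respectively.
    have key : ∀ (σ : FPFI (Fin 4)) (ρ : Equiv.Perm D.HalfEdge),
        ρ a = ![a, τ a, c, τ c] (σ.1 0) → ρ (τ a) = ![a, τ a, c, τ c] (σ.1 1) →
        ρ c = ![a, τ a, c, τ c] (σ.1 2) → ρ (τ c) = ![a, τ a, c, τ c] (σ.1 3) →
        (∀ x, x ≠ a → x ≠ τ a → x ≠ c → x ≠ τ c → ρ x = τ x) →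
        Function.Involutive.toPerm _ (Diagram.joinFun_joinFun hτ hpt hc σ) = ρ := by
      intro σ ρ k0 k1 k2 k3 k
      ext x
      change Diagram.joinFun _ _ _ x = _
      by_cases hx : ∃ i, ![a, τ a, c, τ c] i = x
      · obtain ⟨i, rfl⟩ := hx
        rw [Diagram.joinFun_pt hpt]
        fin_cases i
        exacts [k0.symm, k1.symm, k2.symm, k3.symm]
      · push Not at hx
        rw [Diagram.joinFun_of_ne _ hx]
        exact (k x (hx 0).symm (hx 1).symm (hx 2).symm (hx 3).symm).symm
    have e₁ := key FPFI.four₁ τ rfl (h2 a) rfl (h2 c) (fun x _ _ _ _ => rfl)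
    have e₂ := key FPFI.four₂ (swapEnds τ a c) (by change _ = τ c; grind [swapEnds_apply])
      (by change _ = c; grind [swapEnds_apply]) (by change _ = τ a; grind [swapEnds_apply])
      (by change _ = a; grind [swapEnds_apply]) (by grind [swapEnds_apply])
    have e₃ := key FPFI.four₃ (swapEnds τ a (τ c)) (by change _ = c; grind [swapEnds_apply])
      (by change _ = τ c; grind [swapEnds_apply]) (by change _ = a; grind [swapEnds_apply])
      (by change _ = τ a; grind [swapEnds_apply]) (by grind [swapEnds_apply])
    rwa [e₁, e₂, e₃] at h

/-- Closed diagrams of degree at least two are pairings with the sum of all pairs of struts. -/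
theorem gr_le_strutImage {m : ℕ} (hm : 2 ≤ m) : gr Empty m ≤ strutImage m := by
  classical
  refine Submodule.span_le.2 ?_
  rintro x ⟨D, hD, rfl⟩
  have := Fintype.ofFinite D.HalfEdge
  have h1 := D.two_mul_degree
  have h2 := D.three_mul_numTrivalent
  have h3 := D.card_halfEdge
  have h4 : Nat.card Empty = 0 := by simp
  -- There are `2m` trivalent vertices and `6m` half-edges; `2 ≤ m` is what makes this exceed six.
  have h := (isWeight_weight D hD).eq_zero D.isMatching_flip
    (by rw [← Nat.card_eq_fintype_card]; omega)
  rw [weight_of_isMatching D m D.isMatching_flip] at h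
  exact (Submodule.Quotient.mk_eq_zero _).1 h

end Space

/-! ### Passage to the completion -/

theorem degreeAbove_le_strutIdeal : degreeAbove 1 ≤ strutIdeal 2 := by
  intro f hf
  -- Membership in `strutIdeal 2` is tested degree by degree: the components of degree at most one
  -- vanish, and all others are pairings with `strutSum 2`.
  refine (exists_completedPair_iff 2 f).2 fun m => ?_
  by_cases hm : 2 ≤ m
  · exact Space.gr_le_strutImage hm (f.2 m)
  · exact ⟨0, zero_mem _, by rw [hf m (by omega)]; simp⟩

theorem strutQuotientPart_eq_bot {m : ℕ} (hm : 2 ≤ m) : strutQuotientPart 2 m = ⊥ := by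
  rw [eq_bot_iff]
  rintro _ ⟨f, hf, rfl⟩
  refine (Submodule.mem_bot ℂ).2 (Ideal.Quotient.eq_zero_iff_mem.2 (degreeAbove_le_strutIdeal ?_))
  exact fun d hd => hf d (by omega)

end Jacobi

theorem mainTheorem7 :
    (∀ m : ℕ, 2 ≤ m → Jacobi.strutQuotientPart 2 m = ⊥) ∧
    (∃ e : Jacobi.CAlg 1 ≃ₐ[ℂ] Jacobi.DAlg 1,
      (e : Jacobi.CAlg 1 →ₐ[ℂ] Jacobi.DAlg 1) = Jacobi.pr 1) ∧
    Jacobi.strutIdeal 2 ⊔ Jacobi.loopIdeal 1 =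
      Jacobi.strutIdeal 2 ⊔ Jacobi.loopIdeal 1 ⊔ Jacobi.degreeAbove 1 := by
  have h : Jacobi.strutIdeal 2 ⊔ Jacobi.loopIdeal 1 =
      Jacobi.strutIdeal 2 ⊔ Jacobi.loopIdeal 1 ⊔ Jacobi.degreeAbove 1 :=
    (sup_eq_left.2 (Jacobi.degreeAbove_le_strutIdeal.trans le_sup_left)).symm
  refine ⟨fun m => Jacobi.strutQuotientPart_eq_bot, ⟨Ideal.quotientEquivAlgOfEq ℂ h, ?_⟩, h⟩
  exact Ideal.Quotient.algHom_ext _ (AlgHom.ext fun x => rfl)
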